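/- Let $\Bbbk$ be a field of characteristic $\neq 2$, let $0\le r\le n$, $0\le s\le m$, and let $V=\Bbbk^{n|m}$ be the standard superspace with parity reversal $\Pi V$. Superspaces are described by their points with values in arbitrary commutative superalgebras $A$ over $\Bbbk$; a morphism is a map on $A$-points natural in $A$. Super Grassmannian. $G_{r|s}(V)(A)$ is the set of even $r|s\times n|m$ matrices $U$ over $A$ which contain an invertible $r|s\times r|s$ submatrix (the rows of $U$ are a basis of an $r|s$-plane $L$), modulo $U\sim gU$, $g\in GL(r|s)(A)$. The plane $\Pi L\subset \Pi V$ is represented by the parity-reversed matrix $U^\Pi$. Multivectors. An $A$-point of $\Lambda^{r|s}(V)$ is an even rational function $F$, with parameters in $A$, of an even $n|m\times r|s$ matrix $P=(p_a{}^i)$, that is, of $r$ even and $s$ odd covectors, such that $$F(Pg)=F(P)\,\mathrm{Ber}\,g\quad (g\in GL(r|s)),\qquad \frac{\partial^2F}{\partial p_a{}^i\,\partial p_b{}^j}+(-1)^{\tilde\imath\tilde\jmath+\tilde a(\tilde\imath+\tilde\jmath)}\frac{\partial^2F}{\partial p_a{}^j\,\partial p_b{}^i}=0$$ for all $a,b,i,j$,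 the tilde denoting parity. As a function on a superspace, $F$ may be evaluated at matrices with entries in any superalgebra over $A$, naturally. Rational functions are given on domains where a polynomial in the even entries of $P$, whose coefficients generate the unit ideal of $A_0$, is invertible, and are identified when they agree on a smaller domain of this kind. Here $\mathrm{Ber}\,g=\det(g_{00}-g_{01}g_{11}^{-1}g_{10})/\det g_{11}$. The elements of $\Lambda^{s|r}(\Pi V)$ are defined in the same way, with $(n|m,\,r|s)$ replaced by $(m|n,\,s|r)$. Weighted projective superspace. $P_{1,-1}(\Lambda^{r|s}(V)\oplus\Lambda^{s|r}(\Pi V))(A)$ is the set of pairs $(F,G)$, $F\in\Lambda^{r|s}(V)(A)$, $G\in\Lambda^{s|r}(\Pi V)(A)$, both non-zero (after every base change of $A$ to a non-zero superalgebra), modulo $(F,G)\sim(\lambda F,\lambda^{-1}G)$, $\lambda\in A_0^\times$. Theorem. For a matrix $U$ representing $L$ put $\mathrm{pl}(U)(P)=\mathrm{Ber}(UP)$ and $\mathrm{pl}^*(U)=\mathrm{pl}(U^\Pi)$, i.e. $\mathrm{pl}^*(U)(P^\Pi)=\mathrm{Ber}^*(UP):=\mathrm{Ber}((UP)^\Pi)$.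 Then $\mathrm{pl}(U)$ and $\mathrm{pl}^*(U)$ are non-zero elements of $\Lambda^{r|s}(V)$ and $\Lambda^{s|r}(\Pi V)$ respectively, the class of $(\mathrm{pl}(U),\mathrm{pl}^*(U))$ depends only on $L$, and the resulting super Plücker map $$\mathrm{Pl}\colon G_{r|s}(V)\to P_{1,-1}\bigl(\Lambda^{r|s}(V)\oplus\Lambda^{s|r}(\Pi V)\bigr),\qquad L\mapsto[\mathrm{pl}(U):\mathrm{pl}^*(U)],$$ is a morphism and an embedding, i.e. it is an isomorphism of $G_{r|s}(V)$ onto its image: it has an inverse morphism defined on its image. -/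

import Mathlib

open CategoryTheory

universe u

/-! ### Commutative superalgebras -/

/-- A commutative superalgebra over a field `𝕜`: a `ℤ/2`-graded `𝕜`-algebra in which homogeneous
elements commute up to the sign rule and in which odd elements have square zero (the latter is
automatic when `2` is invertible). -/
structure SuperAlg (𝕜 : Type u) [Field 𝕜] where
  carrier : Type u
  [ring : Ring carrier]
  [algebra : Algebra 𝕜 carrier]
  /-- `gr 0` is the even part and `gr 1` the odd part. -/
  gr : ZMod 2 → Submodule 𝕜 carrier
  [graded : GradedAlgebra gr]
  comm : ∀ {i j : ZMod 2} {a b : carrier}, a ∈ gr i → b ∈ gr j →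
    a * b = (-1) ^ (i.val * j.val) * (b * a)
  odd_sq : ∀ {a : carrier}, a ∈ gr 1 → a * a = 0

namespace SuperAlg

variable {𝕜 : Type u} [Field 𝕜]

instance (A : SuperAlg 𝕜) : Ring A.carrier := A.ring
instance (A : SuperAlg 𝕜) : Algebra 𝕜 A.carrier := A.algebra
instance (A : SuperAlg 𝕜) : GradedAlgebra A.gr := A.graded

/-- The even part of a commutative superalgebra, a commutative ring. -/
abbrev Even (A : SuperAlg 𝕜) : Type u := A.gr 0

instance (A : SuperAlg 𝕜) : CommRing A.Even :=
  { (inferInstance : Ring A.Even) with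
    mul_comm := fun a b => Subtype.ext (by
      have h := A.comm a.2 b.2
      simpa using h) }

/-- Morphisms of superalgebras: parity preserving algebra homomorphisms. -/
@[ext]
structure Hom (A B : SuperAlg 𝕜) where
  toAlgHom : A.carrier →ₐ[𝕜] B.carrier
  map_mem : ∀ {i : ZMod 2} {a : A.carrier}, a ∈ A.gr i → toAlgHom a ∈ B.gr i

instance : Category.{u} (SuperAlg 𝕜) where
  Hom A B := Hom A B
  id A := ⟨AlgHom.id 𝕜 A.carrier, fun h => h⟩
  comp φ ψ := ⟨ψ.toAlgHom.comp φ.toAlgHom, fun h => ψ.map_mem (φ.map_mem h)⟩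

/-- The underlying function of a morphism. -/
def app {A B : SuperAlg 𝕜} (φ : A ⟶ B) : A.carrier →ₐ[𝕜] B.carrier := Hom.toAlgHom φ

theorem app_mem {A B : SuperAlg 𝕜} (φ : A ⟶ B) {i : ZMod 2} {a : A.carrier} (h : a ∈ A.gr i) :
    app φ a ∈ B.gr i := Hom.map_mem φ h

@[simp] theorem app_id (A : SuperAlg 𝕜) (a : A.carrier) : app (𝟙 A) a = a := rfl

@[simp] theorem app_comp {A B C : SuperAlg 𝕜} (φ : A ⟶ B) (ψ : B ⟶ C) (a : A.carrier) :
    app (φ ≫ ψ) a = app ψ (app φ a) := rfl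

/-- The ring homomorphism between the even parts. -/
def even {A B : SuperAlg 𝕜} (φ : A ⟶ B) : A.Even →+* B.Even where
  toFun a := ⟨app φ a, app_mem φ a.2⟩
  map_one' := Subtype.ext (map_one (app φ))
  map_mul' _ _ := Subtype.ext (map_mul (app φ) _ _)
  map_zero' := Subtype.ext (map_zero (app φ))
  map_add' _ _ := Subtype.ext (map_add (app φ) _ _)

@[simp] theorem coe_even {A B : SuperAlg 𝕜} (φ : A ⟶ B) (a : A.Even) :
    ((even φ a : B.Even) : B.carrier) = app φ a := rfl

theorem even_comp {A B C : SuperAlg 𝕜} (φ : A ⟶ B) (ψ : B ⟶ C) :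
    even (φ ≫ ψ) = (even ψ).comp (even φ) := rfl

theorem even_id (A : SuperAlg 𝕜) : even (𝟙 A) = RingHom.id A.Even := rfl

theorem mul_mem_gr (A : SuperAlg 𝕜) {i j k : ZMod 2} {a b : A.carrier}
    (ha : a ∈ A.gr i) (hb : b ∈ A.gr j) (h : i + j = k) : a * b ∈ A.gr k :=
  h ▸ SetLike.mul_mem_graded ha hb

end SuperAlg

/-! ### Even supermatrices and the Berezinian -/

/-- The parity of an index: the first `p` indices are even, the last `q` are odd. -/
def par {p q : ℕ} : Fin p ⊕ Fin q → ZMod 2 := Sum.elim (fun _ => 0) (fun _ => 1)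

theorem par_swap {p q : ℕ} (x : Fin p ⊕ Fin q) : par x.swap = par x + 1 := by
  rcases x with x | x
  · exact (zero_add 1).symm
  · change (0 : ZMod 2) = 1 + 1
    decide

/-- Even supermatrices of size `p|q × p'|q'` over `A`: the entry in row `i` and column `j` has
parity the sum of the parities of `i` and `j`. -/
@[ext]
structure SMat {𝕜 : Type u} [Field 𝕜] (A : SuperAlg 𝕜) (p q p' q' : ℕ) where
  val : Matrix (Fin p ⊕ Fin q) (Fin p' ⊕ Fin q') A.carrier
  mem : ∀ i j, val i j ∈ A.gr (par i + par j)

namespace SMat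

open SuperAlg

variable {𝕜 : Type u} [Field 𝕜] {A B C : SuperAlg 𝕜} {p q p' q' p'' q'' p₃ q₃ : ℕ}

/-- Matrix multiplication. -/
def mul (M : SMat A p q p' q') (N : SMat A p' q' p'' q'') : SMat A p q p'' q'' where
  val := M.val * N.val
  mem i j := by
    rw [Matrix.mul_apply]
    refine Submodule.sum_mem _ fun k _ => A.mul_mem_gr (M.mem i k) (N.mem k j) ?_
    have h : ∀ a b c : ZMod 2, a + b + (b + c) = a + c := by decide
    exact h _ _ _

/-- The identity matrix. -/
def one (A : SuperAlg 𝕜) (p q : ℕ) : SMat A p q p q where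
  val := 1
  mem i j := by
    by_cases h : i = j
    · subst h
      have h2 : ∀ a : ZMod 2, a + a = 0 := by decide
      rw [Matrix.one_apply_eq, h2]
      exact SetLike.GradedOne.one_mem
    · rw [Matrix.one_apply_ne h]
      exact Submodule.zero_mem _

/-- Base change along a morphism of superalgebras. -/
def map (φ : A ⟶ B) (M : SMat A p q p' q') : SMat B p q p' q' where
  val := M.val.map (app φ)
  mem i j := app_mem φ (M.mem i j)

/-- Parity reversion: the labels of rows and columns are changed to the opposite, so that
the even block comes last and the odd block first. -/
def pi (M : SMat A p q p' q') : SMat A q p q' p' where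
  val := M.val.submatrix Sum.swap Sum.swap
  mem i j := by
    have h := M.mem i.swap j.swap
    have h2 : ∀ a b : ZMod 2, a + 1 + (b + 1) = a + b := by decide
    rwa [par_swap, par_swap, h2] at h

/-- The submatrix formed by the columns with even indices `a` and odd indices `μ`. -/
def cols {r s : ℕ} (M : SMat A p q p' q') (a : Fin r ↪o Fin p') (μ : Fin s ↪o Fin q') :
    SMat A p q r s where
  val := M.val.submatrix id (Sum.map a μ)
  mem i j := by
    have h := M.mem i (Sum.map a μ j)
    rcases j with j | j <;> exact h

/-- The matrix `M` with `ε` added to the entry in row `i` and column `j`. -/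
def addSingle (M : SMat A p q p' q') (i : Fin p ⊕ Fin q) (j : Fin p' ⊕ Fin q') (ε : A.carrier)
    (hε : ε ∈ A.gr (par i + par j)) : SMat A p q p' q' where
  val := M.val + Matrix.single i j ε
  mem k l := by
    refine Submodule.add_mem _ (M.mem k l) ?_
    by_cases h : i = k ∧ j = l
    · obtain ⟨rfl, rfl⟩ := h
      rwa [Matrix.single_apply_same]
    · rw [Matrix.single_apply_of_ne i j ε k l h]
      exact Submodule.zero_mem _

/-- The even-even block. -/
def b00 (M : SMat A p q p' q') : Matrix (Fin p) (Fin p') A.Even :=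
  Matrix.of fun i j => ⟨M.val (Sum.inl i) (Sum.inl j), by
    simpa [par] using M.mem (Sum.inl i) (Sum.inl j)⟩

/-- The odd-odd block (its entries are even). -/
def b11 (M : SMat A p q p' q') : Matrix (Fin q) (Fin q') A.Even :=
  Matrix.of fun i j => ⟨M.val (Sum.inr i) (Sum.inr j), by
    have h := M.mem (Sum.inr i) (Sum.inr j)
    have h2 : (1 + 1 : ZMod 2) = 0 := by decide
    simpa [par, h2] using h⟩

/-- The matrix `g₀₀ - g₀₁ g₁₁⁻¹ g₁₀`. -/
noncomputable def schur (g : SMat A p q p q) : Matrix (Fin p) (Fin p) A.Even :=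
  Matrix.of fun i j =>
    ⟨g.val (Sum.inl i) (Sum.inl j) - ∑ k, ∑ l, g.val (Sum.inl i) (Sum.inr k) *
        ((g.b11⁻¹ k l : A.Even) : A.carrier) * g.val (Sum.inr l) (Sum.inl j), by
      refine Submodule.sub_mem _ (by simpa [par] using g.mem (Sum.inl i) (Sum.inl j))
        (Submodule.sum_mem _ fun k _ => Submodule.sum_mem _ fun l _ => ?_)
      exact A.mul_mem_gr (A.mul_mem_gr (g.mem (Sum.inl i) (Sum.inr k)) (g.b11⁻¹ k l).2 rfl)
        (g.mem (Sum.inr l) (Sum.inl j)) (by simp only [par, Sum.elim_inl, Sum.elim_inr]; decide)⟩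

/-- The Berezinian `det (g₀₀ - g₀₁ g₁₁⁻¹ g₁₀) / det g₁₁`
(meaningful where the block `g₁₁` is invertible). -/
noncomputable def ber (g : SMat A p q p q) : A.Even :=
  g.schur.det * Ring.inverse g.b11.det

/-- The inverse Berezinian `Ber* g = Ber (g^Π)`. -/
noncomputable def berStar (g : SMat A p q p q) : A.Even := g.pi.ber

/-- Invertibility of an even square supermatrix: the elements of `GL(p|q)`. -/
def IsInv (g : SMat A p q p q) : Prop := ∃ h : SMat A p q p q, g.mul h = one A p q ∧
  h.mul g = one A p q

theorem mul_assoc' (M : SMat A p q p' q') (N : SMat A p' q' p'' q'') (K : SMat A p'' q'' p₃ q₃) :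
    (M.mul N).mul K = M.mul (N.mul K) := SMat.ext (Matrix.mul_assoc M.val N.val K.val)

theorem one_mul' (M : SMat A p q p' q') : (one A p q).mul M = M :=
  SMat.ext (Matrix.one_mul M.val)

theorem mul_one' (M : SMat A p q p' q') : M.mul (one A p' q') = M :=
  SMat.ext (Matrix.mul_one M.val)

theorem map_mul (φ : A ⟶ B) (M : SMat A p q p' q') (N : SMat A p' q' p'' q'') :
    (M.mul N).map φ = (M.map φ).mul (N.map φ) :=
  SMat.ext (by
    ext i j
    simp [map, mul, Matrix.mul_apply])

theorem map_one (φ : A ⟶ B) : (one A p q).map φ = one B p q :=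
  SMat.ext (by
    ext i j
    by_cases h : i = j
    · subst h; simp [map, one]
    · simp [map, one, Matrix.one_apply_ne h])

theorem map_id (M : SMat A p q p' q') : M.map (𝟙 A) = M := rfl

theorem map_comp (φ : A ⟶ B) (ψ : B ⟶ C) (M : SMat A p q p' q') :
    M.map (φ ≫ ψ) = (M.map φ).map ψ := rfl

theorem mul_cols {r s : ℕ} (M : SMat A p q p' q') (N : SMat A p' q' p'' q'')
    (a : Fin r ↪o Fin p'') (μ : Fin s ↪o Fin q'') :
    (M.mul N).cols a μ = M.mul (N.cols a μ) := rfl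

theorem pi_pi (M : SMat A p q p' q') : M.pi.pi = M :=
  SMat.ext (by
    ext i j
    simp [pi])

theorem pi_mul (M : SMat A p q p' q') (N : SMat A p' q' p'' q'') :
    (M.mul N).pi = M.pi.mul N.pi :=
  SMat.ext (by
    ext i j
    change ∑ k, M.val i.swap k * N.val k j.swap =
      ∑ k : Fin q' ⊕ Fin p', M.val i.swap (Sum.swap k) * N.val (Sum.swap k) j.swap
    exact ((Equiv.sumComm (Fin q') (Fin p')).sum_comp
      (fun k => M.val i.swap k * N.val k j.swap)).symm)

theorem pi_one : (one A p q).pi = one A q p :=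
  SMat.ext (by
    ext i j
    change (1 : Matrix (Fin p ⊕ Fin q) (Fin p ⊕ Fin q) A.carrier) i.swap j.swap =
      (1 : Matrix (Fin q ⊕ Fin p) (Fin q ⊕ Fin p) A.carrier) i j
    simp only [Matrix.one_apply]
    congr 1
    exact propext (Equiv.sumComm (Fin q) (Fin p)).injective.eq_iff)

theorem pi_cols {r s : ℕ} (M : SMat A p q p' q') (a : Fin r ↪o Fin p') (μ : Fin s ↪o Fin q') :
    (M.cols a μ).pi = M.pi.cols μ a :=
  SMat.ext (by
    ext i j
    rcases j with j | j <;> rfl)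

theorem IsInv.one (A : SuperAlg 𝕜) (p q : ℕ) : (SMat.one A p q).IsInv :=
  ⟨SMat.one A p q, one_mul' _, one_mul' _⟩

theorem IsInv.mul {g h : SMat A p q p q} (hg : g.IsInv) (hh : h.IsInv) : (g.mul h).IsInv := by
  obtain ⟨g', h1, h2⟩ := hg
  obtain ⟨k', h3, h4⟩ := hh
  refine ⟨k'.mul g', ?_, ?_⟩
  · rw [mul_assoc', ← mul_assoc' h, h3, one_mul', h1]
  · rw [mul_assoc', ← mul_assoc' g', h2, one_mul', h4]

theorem IsInv.map (φ : A ⟶ B) {g : SMat A p q p q} (hg : g.IsInv) : (g.map φ).IsInv := by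
  obtain ⟨g', h1, h2⟩ := hg
  exact ⟨g'.map φ, by rw [← map_mul, h1, map_one], by rw [← map_mul, h2, map_one]⟩

theorem IsInv.pi {g : SMat A p q p q} (hg : g.IsInv) : g.pi.IsInv := by
  obtain ⟨g', h1, h2⟩ := hg
  exact ⟨g'.pi, by rw [← pi_mul, h1, pi_one], by rw [← pi_mul, h2, pi_one]⟩

theorem isNilpotent_of_odd_mul (A : SuperAlg 𝕜) (x : A.Even) (a b : A.carrier) (ha : a ∈ A.gr 1)
    (hb : b ∈ A.gr 1) (hx : (x : A.carrier) = a * b) : IsNilpotent x := by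
  refine ⟨2, Subtype.ext ?_⟩
  have h : b * a = -(a * b) := by
    have := A.comm hb ha
    simpa [ZMod.val_one] using this
  change ((x ^ 2 : A.Even) : A.carrier) = 0
  rw [pow_two]
  change (x : A.carrier) * x = 0
  rw [hx, mul_assoc, ← mul_assoc b, h, neg_mul, mul_assoc, A.odd_sq hb]
  simp

/-- The odd-odd block of a product agrees with the product of the odd-odd blocks up to nilpotents;
hence the two determinants are invertible at the same time. -/
theorem isUnit_det_b11_mul (M : SMat A p q p' q') (N : SMat A p' q' p q) :
    IsUnit (M.mul N).b11.det ↔ IsUnit (M.b11 * N.b11).det := by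
  have key : ∀ K L : Matrix (Fin q) (Fin q) A.Even,
      (∀ i j, K i j - L i j ∈ nilradical A.Even) → IsUnit L.det → IsUnit K.det := by
    intro K L h hL
    have h1 : K.det - L.det ∈ nilradical A.Even := by
      rw [← Ideal.Quotient.eq, RingHom.map_det, RingHom.map_det]
      congr 1
      ext i j
      exact Ideal.Quotient.eq.mpr (h i j)
    have h2 := (mem_nilradical.mp h1).isUnit_add_left_of_commute hL (Commute.all _ _)
    simpa using h2
  have diff : ∀ i j, (M.mul N).b11 i j - (M.b11 * N.b11) i j ∈ nilradical A.Even := by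
    intro i j
    have e : (M.mul N).b11 i j - (M.b11 * N.b11) i j =
        ∑ k : Fin p', (⟨M.val (Sum.inr i) (Sum.inl k) * N.val (Sum.inl k) (Sum.inr j),
          A.mul_mem_gr (M.mem (Sum.inr i) (Sum.inl k)) (N.mem (Sum.inl k) (Sum.inr j))
            (by simp only [par, Sum.elim_inl, Sum.elim_inr]; decide)⟩ : A.Even) := by
      refine Subtype.ext ?_
      rw [AddSubgroupClass.coe_sub, AddSubmonoidClass.coe_finsetSum, Matrix.mul_apply,
        AddSubmonoidClass.coe_finsetSum]
      change (M.val * N.val) (Sum.inr i) (Sum.inr j) - ∑ k,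
        M.val (Sum.inr i) (Sum.inr k) * N.val (Sum.inr k) (Sum.inr j) = _
      rw [Matrix.mul_apply, Fintype.sum_sum_type]
      exact add_sub_cancel_right _ _
    rw [e]
    refine Ideal.sum_mem _ fun k _ => mem_nilradical.mpr ?_
    refine isNilpotent_of_odd_mul A _ _ _ ?_ ?_ rfl
    · simpa [par] using M.mem (Sum.inr i) (Sum.inl k)
    · simpa [par] using N.mem (Sum.inl k) (Sum.inr j)
  refine ⟨key _ _ fun i j => ?_, key _ _ diff⟩
  rw [← neg_sub]
  exact neg_mem (diff i j)

theorem IsInv.isUnit_det_b11 {g : SMat A p q p q} (hg : g.IsInv) : IsUnit g.b11.det := by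
  obtain ⟨h, h1, -⟩ := hg
  have e : (SMat.one A p q).b11 = 1 := by
    ext i j
    by_cases hij : i = j
    · subst hij; simp [b11, SMat.one]
    · simp [b11, SMat.one, hij]
  have := (isUnit_det_b11_mul g h).mp (by rw [h1, e]; simp)
  rw [Matrix.det_mul] at this
  exact isUnit_of_mul_isUnit_left this

theorem map_b11 (φ : A ⟶ B) (M : SMat A p q p' q') : (M.map φ).b11 = M.b11.map (even φ) := rfl

/-- The Berezinian is compatible with base change. -/
theorem ber_map (φ : A ⟶ B) (g : SMat A p q p q) (hg : IsUnit g.b11.det) :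
    (g.map φ).ber = even φ g.ber := by
  have h1 : ((g.map φ).b11).det = even φ g.b11.det := by
    rw [map_b11, RingHom.map_det]; rfl
  have hinv : (g.map φ).b11⁻¹ = (g.b11⁻¹).map (even φ) := by
    refine Matrix.inv_eq_right_inv ?_
    rw [map_b11, ← Matrix.map_mul, Matrix.mul_nonsing_inv _ hg]
    exact Matrix.map_one _ (_root_.map_zero _) (_root_.map_one _)
  have h2 : (g.map φ).schur = g.schur.map (even φ) := by
    ext i j
    simp only [schur, Matrix.of_apply, Matrix.map_apply, coe_even, map_sub, map_sum, hinv,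
      _root_.map_mul]
    rfl
  have h3 : (g.map φ).schur.det = even φ g.schur.det := by
    rw [h2, RingHom.map_det]; rfl
  have h4 : Ring.inverse (even φ g.b11.det) = even φ (Ring.inverse g.b11.det) := by
    obtain ⟨v, hv⟩ := hg
    rw [← hv, Ring.inverse_unit]
    exact Ring.inverse_unit (Units.map (even φ : A.Even →* B.Even) v)
  rw [ber, ber, h1, h3, h4, _root_.map_mul]

end SMat

/-! ### The super Grassmannian -/

/-- Bases of `r|s`-planes in the superspace of dimension `n|m`, with parameters in `A`: the even
`r|s × n|m` matrices over `A` of rank `r|s`, i.e. those containing an invertible `r|s × r|s`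
submatrix formed by `r` even and `s` odd columns. The rows are the left coordinates of the
basis vectors of the plane. -/
@[ext]
structure Frame {𝕜 : Type u} [Field 𝕜] (A : SuperAlg 𝕜) (n m r s : ℕ) where
  mat : SMat A r s n m
  rank : ∃ (a : Fin r ↪o Fin n) (μ : Fin s ↪o Fin m), (mat.cols a μ).IsInv

namespace Frame

variable {𝕜 : Type u} [Field 𝕜] {A B C : SuperAlg 𝕜} {n m r s : ℕ}

/-- Base change. -/
def map (φ : A ⟶ B) (U : Frame A n m r s) : Frame B n m r s where
  mat := U.mat.map φ
  rank := by
    obtain ⟨a, μ, h⟩ := U.rank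
    exact ⟨a, μ, h.map φ⟩

/-- Parity reversion: the basis of the plane `ΠL ⊂ ΠV`. -/
def pi (U : Frame A n m r s) : Frame A m n s r where
  mat := U.mat.pi
  rank := by
    obtain ⟨a, μ, h⟩ := U.rank
    exact ⟨μ, a, by rw [← SMat.pi_cols]; exact h.pi⟩

/-- Two bases span the same plane if they differ by an element of `GL(r|s)`. -/
instance setoid (A : SuperAlg 𝕜) (n m r s : ℕ) : Setoid (Frame A n m r s) where
  r U U' := ∃ g : SMat A r s r s, g.IsInv ∧ U'.mat = g.mul U.mat
  iseqv :=
    { refl := fun U => ⟨SMat.one A r s, SMat.IsInv.one A r s, (SMat.one_mul' _).symm⟩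
      symm := by
        rintro U U' ⟨g, ⟨h, h1, h2⟩, e⟩
        exact ⟨h, ⟨g, h2, h1⟩, by rw [e, ← SMat.mul_assoc', h2, SMat.one_mul']⟩
      trans := by
        rintro U U' U'' ⟨g, hg, e⟩ ⟨g', hg', e'⟩
        exact ⟨g'.mul g, hg'.mul hg, by rw [e', e, SMat.mul_assoc']⟩ }

theorem map_rel (φ : A ⟶ B) {U U' : Frame A n m r s} (h : U ≈ U') : U.map φ ≈ U'.map φ := by
  obtain ⟨g, hg, e⟩ := h
  exact ⟨g.map φ, hg.map φ, by
    change U'.mat.map φ = _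
    rw [e, SMat.map_mul]; rfl⟩

end Frame

/-- The super Grassmannian `G_{r|s}(V)`, `dim V = n|m`, through its functor of points:
`G_{r|s}(V) = St_{r|s}(V) / GL(r|s)`. -/
def superGrassmannian (𝕜 : Type u) [Field 𝕜] (n m r s : ℕ) : SuperAlg.{u} 𝕜 ⥤ Type u where
  obj A := Quotient (Frame.setoid A n m r s)
  map φ := TypeCat.ofHom (Quotient.map (Frame.map φ) fun _ _ h => Frame.map_rel φ h)
  map_id A := by
    ext x
    induction x using Quotient.inductionOn
    rfl
  map_comp φ ψ := by
    ext x
    induction x using Quotient.inductionOn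
    rfl

/-! ### Rational functions of supermatrices -/

/-- The coefficients of the polynomial generate the unit ideal: its non-vanishing locus is dense
in every fibre over the ring of coefficients. -/
def UnitContent {σ R : Type*} [CommRing R] (f : MvPolynomial σ R) : Prop :=
  Ideal.span (Set.range fun d => f.coeff d) = ⊤

namespace UnitContent

variable {σ R S : Type*} [CommRing R] [CommRing S]

theorem map_mk_eq_zero {f : MvPolynomial σ R} {I : Ideal R} :
    MvPolynomial.map (Ideal.Quotient.mk I) f = 0 ↔
      Ideal.span (Set.range fun d => f.coeff d) ≤ I := by
  rw [Ideal.span_le, MvPolynomial.ext_iff]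
  constructor
  · rintro h _ ⟨d, rfl⟩
    have := h d
    rw [MvPolynomial.coeff_map, MvPolynomial.coeff_zero] at this
    exact Ideal.Quotient.eq_zero_iff_mem.mp this
  · intro h d
    rw [MvPolynomial.coeff_map, MvPolynomial.coeff_zero]
    exact Ideal.Quotient.eq_zero_iff_mem.mpr (h ⟨d, rfl⟩)

theorem of_isUnit_eval {f : MvPolynomial σ R} (x : σ → R) (h : IsUnit (MvPolynomial.eval x f)) :
    UnitContent f := by
  refine Ideal.eq_top_of_isUnit_mem _ ?_ h
  rw [← Ideal.Quotient.eq_zero_iff_mem]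
  have h0 := map_mk_eq_zero.mpr (le_refl (Ideal.span (Set.range fun d => f.coeff d)))
  have := congrArg (MvPolynomial.eval fun i =>
    Ideal.Quotient.mk (Ideal.span (Set.range fun d => f.coeff d)) (x i)) h0
  rw [MvPolynomial.eval_map, map_zero] at this
  rw [← this]
  exact MvPolynomial.hom_eval₂ f (RingHom.id R)
    (Ideal.Quotient.mk (Ideal.span (Set.range fun d => f.coeff d))) x

theorem one : UnitContent (1 : MvPolynomial σ R) :=
  of_isUnit_eval (fun _ => 0) (by simp)

theorem mul {f g : MvPolynomial σ R} (hf : UnitContent f) (hg : UnitContent g) :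
    UnitContent (f * g) := by
  by_contra h
  obtain ⟨M, hM, hle⟩ := Ideal.exists_le_maximal _ h
  have h0 := map_mk_eq_zero.mpr hle
  rw [map_mul] at h0
  have : M.IsPrime := hM.isPrime
  rcases mul_eq_zero.mp h0 with h1 | h1
  · exact hM.ne_top (top_le_iff.mp (hf ▸ map_mk_eq_zero.mp h1))
  · exact hM.ne_top (top_le_iff.mp (hg ▸ map_mk_eq_zero.mp h1))

theorem map (φ : R →+* S) {f : MvPolynomial σ R} (hf : UnitContent f) :
    UnitContent (MvPolynomial.map φ f) := by
  have h : Ideal.map φ (Ideal.span (Set.range fun d => f.coeff d)) = ⊤ := by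
    rw [show Ideal.span (Set.range fun d => f.coeff d) = ⊤ from hf, Ideal.map_top]
  rw [Ideal.map_span, ← Set.range_comp] at h
  unfold UnitContent
  simp only [MvPolynomial.coeff_map]
  exact h

end UnitContent

/-- The even coordinates on the superspace of even `n|m × r|s` matrices. -/
abbrev EvenCoord (n m r s : ℕ) : Type := (Fin n × Fin r) ⊕ (Fin m × Fin s)

/-- The values of the even coordinates. -/
def SMat.coord {𝕜 : Type u} [Field 𝕜] {A : SuperAlg 𝕜} {n m r s : ℕ} (P : SMat A n m r s) :
    EvenCoord n m r s → A.Even :=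
  Sum.elim (fun x => P.b00 x.1 x.2) (fun x => P.b11 x.1 x.2)

/-- An `A`-family of rational functions of an even `n|m × r|s` supermatrix `P` (an array of `r`
even and `s` odd covectors), given on the principal open domain where the polynomial `den` in the
even coordinates is invertible. As for any function on a superspace, the matrix `P` may have
entries in an arbitrary superalgebra `B` over `A`, and the values are natural in `B`.
The value outside of the domain is irrelevant. -/
structure RatFun {𝕜 : Type u} [Field 𝕜] (A : SuperAlg.{u} 𝕜) (n m r s : ℕ) where
  den : MvPolynomial (EvenCoord n m r s) A.Even
  den_unitContent : UnitContent den
  val : ∀ {B : SuperAlg.{u} 𝕜}, (A ⟶ B) → SMat B n m r s → B.carrier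
  natural : ∀ {B C : SuperAlg.{u} 𝕜} (φ : A ⟶ B) (ψ : B ⟶ C) (P : SMat B n m r s),
    IsUnit (den.eval₂ (SuperAlg.even φ) P.coord) →
      val (φ ≫ ψ) (P.map ψ) = SuperAlg.app ψ (val φ P)

namespace RatFun

variable {𝕜 : Type u} [Field 𝕜] {A B C : SuperAlg.{u} 𝕜} {n m r s : ℕ}

/-- The point `P` lies in the domain of the given representation of the rational function. -/
def Dom (F : RatFun A n m r s) (φ : A ⟶ B) (P : SMat B n m r s) : Prop :=
  IsUnit (F.den.eval₂ (SuperAlg.even φ) P.coord)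

/-- Two families define the same rational function if they agree on some (fibrewise dense)
principal open subset of both domains. -/
instance setoid (A : SuperAlg.{u} 𝕜) (n m r s : ℕ) : Setoid (RatFun A n m r s) where
  r F G := ∃ h : MvPolynomial (EvenCoord n m r s) A.Even, UnitContent h ∧
    ∀ (B : SuperAlg.{u} 𝕜) (φ : A ⟶ B) (P : SMat B n m r s),
      IsUnit (h.eval₂ (SuperAlg.even φ) P.coord) → F.Dom φ P ∧ G.Dom φ P ∧ F.val φ P = G.val φ P
  iseqv :=
    { refl := fun F => ⟨F.den, F.den_unitContent, fun _ _ _ h => ⟨h, h, rfl⟩⟩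
      symm := fun ⟨h, hh, H⟩ => ⟨h, hh, fun B φ P hP =>
        ⟨(H B φ P hP).2.1, (H B φ P hP).1, (H B φ P hP).2.2.symm⟩⟩
      trans := by
        rintro F G K ⟨h, hh, H⟩ ⟨h', hh', H'⟩
        refine ⟨h * h', hh.mul hh', fun B φ P hP => ?_⟩
        rw [MvPolynomial.eval₂_mul] at hP
        have h1 := H B φ P (isUnit_of_mul_isUnit_left hP)
        have h2 := H' B φ P (isUnit_of_mul_isUnit_right hP)
        exact ⟨h1.1, h2.2.1, h1.2.2.trans h2.2.2⟩ }

/-- Base change of a family along `φ : A ⟶ B`. -/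
noncomputable def map (φ : A ⟶ B) (F : RatFun A n m r s) : RatFun B n m r s where
  den := MvPolynomial.map (SuperAlg.even φ) F.den
  den_unitContent := F.den_unitContent.map _
  val ψ P := F.val (φ ≫ ψ) P
  natural ψ χ P h := by
    rw [MvPolynomial.eval₂_map, ← SuperAlg.even_comp] at h
    rw [← Category.assoc]
    exact F.natural (φ ≫ ψ) χ P h

theorem map_dom (φ : A ⟶ B) (F : RatFun A n m r s) (ψ : B ⟶ C) (P : SMat C n m r s) :
    (F.map φ).Dom ψ P ↔ F.Dom (φ ≫ ψ) P := by
  unfold Dom map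
  rw [MvPolynomial.eval₂_map, ← SuperAlg.even_comp]

theorem map_rel (φ : A ⟶ B) {F G : RatFun A n m r s} (H : F ≈ G) : F.map φ ≈ G.map φ := by
  obtain ⟨h, hh, H⟩ := H
  refine ⟨MvPolynomial.map (SuperAlg.even φ) h, hh.map _, fun C ψ P hP => ?_⟩
  rw [MvPolynomial.eval₂_map, ← SuperAlg.even_comp] at hP
  rw [map_dom, map_dom]
  exact H C (φ ≫ ψ) P hP

/-- The zero function. -/
noncomputable def zero (A : SuperAlg.{u} 𝕜) (n m r s : ℕ) : RatFun A n m r s where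
  den := 1
  den_unitContent := UnitContent.one
  val _ _ := 0
  natural _ ψ _ _ := (map_zero (SuperAlg.app ψ)).symm

/-- Multiplication of a family of functions by an even scalar. -/
def smul (c : A.Even) (F : RatFun A n m r s) : RatFun A n m r s where
  den := F.den
  den_unitContent := F.den_unitContent
  val φ P := SuperAlg.app φ c * F.val φ P
  natural φ ψ P h := by
    rw [F.natural φ ψ P h, SuperAlg.app_comp, map_mul]

theorem smul_rel (c : A.Even) {F G : RatFun A n m r s} (H : F ≈ G) : F.smul c ≈ G.smul c := by
  obtain ⟨h, hh, H⟩ := H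
  refine ⟨h, hh, fun B φ P hP => ⟨(H B φ P hP).1, (H B φ P hP).2.1, ?_⟩⟩
  change _ * _ = _ * _
  rw [(H B φ P hP).2.2]

/-- `D` is the (left) partial derivative of `F` with respect to the matrix entry `p_a^i`:
`F (p + ε) = F (p) + ε D (p)` for all increments `ε` of the entry with `ε ^ 2 = 0`,
of the parity of the entry. -/
def IsPartial (F : RatFun A n m r s) (a : Fin n ⊕ Fin m) (i : Fin r ⊕ Fin s)
    (D : RatFun A n m r s) : Prop :=
  ∀ (B : SuperAlg.{u} 𝕜) (φ : A ⟶ B) (P : SMat B n m r s) (ε : B.carrier)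
    (hε : ε ∈ B.gr (par a + par i)), ε * ε = 0 → F.Dom φ P → D.Dom φ P →
      F.val φ (P.addSingle a i ε hε) = F.val φ P + ε * D.val φ P

/-- The function `F` is a multivector of degree `r|s`, i.e. an even element of `Λ^{r|s}(V)`
with parameters in `A`: it takes even values and satisfies the covariance condition and the
fundamental equations. -/
structure IsMultivector (F : RatFun A n m r s) : Prop where
  /-- `F` is an even function. -/
  even : ∀ (B : SuperAlg.{u} 𝕜) (φ : A ⟶ B) (P : SMat B n m r s), F.Dom φ P →
    F.val φ P ∈ B.gr 0
  /-- `F (P g) = F (P) Ber g` for `g` in `GL(r|s)`. -/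
  covariant : ∀ (B : SuperAlg.{u} 𝕜) (φ : A ⟶ B) (P : SMat B n m r s) (g : SMat B r s r s),
    g.IsInv → F.Dom φ P → F.Dom φ (P.mul g) → F.val φ (P.mul g) = F.val φ P * g.ber
  /-- `∂²F/∂p_a^i ∂p_b^j + (-1)^{ĩ j̃ + ã (ĩ + j̃)} ∂²F/∂p_a^j ∂p_b^i = 0`, where `D b j` is
  `∂F/∂p_b^j` and `E a i b j` is `∂²F/∂p_a^i ∂p_b^j`. -/
  fundamental : ∃ (D : Fin n ⊕ Fin m → Fin r ⊕ Fin s → RatFun A n m r s)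
    (E : Fin n ⊕ Fin m → Fin r ⊕ Fin s → Fin n ⊕ Fin m → Fin r ⊕ Fin s → RatFun A n m r s),
    (∀ b j, F.IsPartial b j (D b j)) ∧ (∀ a i b j, (D b j).IsPartial a i (E a i b j)) ∧
    ∀ (a b : Fin n ⊕ Fin m) (i j : Fin r ⊕ Fin s) (B : SuperAlg.{u} 𝕜) (φ : A ⟶ B)
      (P : SMat B n m r s), (E a i b j).Dom φ P → (E a j b i).Dom φ P →
      (E a i b j).val φ P + (-1) ^ ((par i).val * (par j).val +
        (par a).val * ((par i).val + (par j).val)) * (E a j b i).val φ P = 0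

theorem IsMultivector.map (φ : A ⟶ B) {F : RatFun A n m r s} (hF : F.IsMultivector) :
    (F.map φ).IsMultivector where
  even C ψ P h := hF.even C (φ ≫ ψ) P ((map_dom _ _ _ _).mp h)
  covariant C ψ P g hg h h' :=
    hF.covariant C (φ ≫ ψ) P g hg ((map_dom _ _ _ _).mp h) ((map_dom _ _ _ _).mp h')
  fundamental := by
    obtain ⟨D, E, h1, h2, h3⟩ := hF.fundamental
    refine ⟨fun b j => (D b j).map φ, fun a i b j => (E a i b j).map φ, ?_, ?_, ?_⟩
    · intro b j C ψ P ε hε h0 hd hd'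
      exact h1 b j C (φ ≫ ψ) P ε hε h0 ((map_dom _ _ _ _).mp hd) ((map_dom _ _ _ _).mp hd')
    · intro a i b j C ψ P ε hε h0 hd hd'
      exact h2 a i b j C (φ ≫ ψ) P ε hε h0 ((map_dom _ _ _ _).mp hd) ((map_dom _ _ _ _).mp hd')
    · intro a b i j C ψ P hd hd'
      exact h3 a b i j C (φ ≫ ψ) P ((map_dom _ _ _ _).mp hd) ((map_dom _ _ _ _).mp hd')

end RatFun

/-- Rational functions of even `n|m × r|s` supermatrices with parameters in `A`. -/
def RatClass {𝕜 : Type u} [Field 𝕜] (A : SuperAlg.{u} 𝕜) (n m r s : ℕ) : Type (u + 1) :=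
  Quotient (RatFun.setoid A n m r s)

namespace RatClass

variable {𝕜 : Type u} [Field 𝕜] {A B C : SuperAlg.{u} 𝕜} {n m r s : ℕ}

/-- Base change. -/
noncomputable def map (φ : A ⟶ B) : RatClass A n m r s → RatClass B n m r s :=
  Quotient.map (RatFun.map φ) fun _ _ h => RatFun.map_rel φ h

/-- Multiplication by an even scalar. -/
def smul (c : A.Even) : RatClass A n m r s → RatClass A n m r s :=
  Quotient.map (RatFun.smul c) fun _ _ h => RatFun.smul_rel c h

/-- The zero function. -/
noncomputable def zero (A : SuperAlg.{u} 𝕜) (n m r s : ℕ) : RatClass A n m r s :=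
  Quotient.mk _ (RatFun.zero A n m r s)

/-- The rational function is an (even) multivector of degree `r|s`, an element of `Λ^{r|s}(V)`. -/
def IsMultivector (F : RatClass A n m r s) : Prop :=
  ∃ f : RatFun A n m r s, Quotient.mk _ f = F ∧ f.IsMultivector

/-- The `A`-family is non-zero at every value of the parameters, i.e. after every base change to
a non-trivial superalgebra. -/
def NowhereZero (F : RatClass A n m r s) : Prop :=
  ∀ (B : SuperAlg.{u} 𝕜) (φ : A ⟶ B), Nontrivial B.carrier → F.map φ ≠ zero B n m r s

theorem map_id (F : RatClass A n m r s) : F.map (𝟙 A) = F := by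
  induction F using Quotient.inductionOn with | _ f
  refine Quotient.sound ⟨f.den, f.den_unitContent, fun B φ P h => ⟨?_, h, ?_⟩⟩
  · rw [RatFun.map_dom, Category.id_comp]; exact h
  · change f.val (𝟙 A ≫ φ) P = _
    rw [Category.id_comp]

theorem map_comp (φ : A ⟶ B) (ψ : B ⟶ C) (F : RatClass A n m r s) :
    F.map (φ ≫ ψ) = (F.map φ).map ψ := by
  induction F using Quotient.inductionOn with | _ f
  refine Quotient.sound ⟨(f.map (φ ≫ ψ)).den, (f.map (φ ≫ ψ)).den_unitContent,
    fun D χ P h => ⟨h, ?_, ?_⟩⟩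
  · rw [RatFun.map_dom, RatFun.map_dom, ← Category.assoc, ← RatFun.map_dom]; exact h
  · change f.val ((φ ≫ ψ) ≫ χ) P = f.val (φ ≫ ψ ≫ χ) P
    rw [Category.assoc]

theorem one_smul (F : RatClass A n m r s) : F.smul 1 = F := by
  induction F using Quotient.inductionOn with | _ f
  refine Quotient.sound ⟨f.den, f.den_unitContent, fun B φ P h => ⟨h, h, ?_⟩⟩
  change SuperAlg.app φ ((1 : A.Even) : A.carrier) * f.val φ P = _
  have : ((1 : A.Even) : A.carrier) = 1 := rfl
  rw [this, map_one, one_mul]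

theorem mul_smul (c d : A.Even) (F : RatClass A n m r s) :
    F.smul (c * d) = (F.smul d).smul c := by
  induction F using Quotient.inductionOn with | _ f
  refine Quotient.sound ⟨f.den, f.den_unitContent, fun B φ P h => ⟨h, h, ?_⟩⟩
  change SuperAlg.app φ ((c * d : A.Even) : A.carrier) * f.val φ P =
    SuperAlg.app φ c * (SuperAlg.app φ d * f.val φ P)
  have : ((c * d : A.Even) : A.carrier) = c * d := rfl
  rw [this, map_mul, mul_assoc]

theorem map_smul (φ : A ⟶ B) (c : A.Even) (F : RatClass A n m r s) :
    (F.smul c).map φ = (F.map φ).smul (SuperAlg.even φ c) := by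
  induction F using Quotient.inductionOn with | _ f
  refine Quotient.sound ⟨(f.map φ).den, (f.map φ).den_unitContent, fun D χ P h => ⟨h, h, ?_⟩⟩
  rfl

theorem IsMultivector.map (φ : A ⟶ B) {F : RatClass A n m r s} (hF : F.IsMultivector) :
    (F.map φ).IsMultivector := by
  obtain ⟨f, rfl, hf⟩ := hF
  exact ⟨f.map φ, rfl, hf.map φ⟩

theorem NowhereZero.map (φ : A ⟶ B) {F : RatClass A n m r s} (hF : F.NowhereZero) :
    (F.map φ).NowhereZero := fun C ψ hC => by
  rw [← map_comp]
  exact hF C (φ ≫ ψ) hC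

end RatClass

/-! ### The weighted projective superspace -/

/-- Homogeneous coordinates on `P_{1,-1}(Λ^{r|s}(V) ⊕ Λ^{s|r}(ΠV))`, `dim V = n|m`, with
parameters in `A`: pairs of non-zero multivectors `F ∈ Λ^{r|s}(V)` and `G ∈ Λ^{s|r}(ΠV)`. -/
@[ext]
structure MvPair {𝕜 : Type u} [Field 𝕜] (A : SuperAlg.{u} 𝕜) (n m r s : ℕ) where
  F : RatClass A n m r s
  G : RatClass A m n s r
  F_mv : F.IsMultivector
  G_mv : G.IsMultivector
  F_ne : F.NowhereZero
  G_ne : G.NowhereZero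

namespace MvPair

variable {𝕜 : Type u} [Field 𝕜] {A B C : SuperAlg.{u} 𝕜} {n m r s : ℕ}

/-- Base change. -/
noncomputable def map (φ : A ⟶ B) (x : MvPair A n m r s) : MvPair B n m r s where
  F := x.F.map φ
  G := x.G.map φ
  F_mv := x.F_mv.map φ
  G_mv := x.G_mv.map φ
  F_ne := x.F_ne.map φ
  G_ne := x.G_ne.map φ

/-- `(F, G) ∼ (λ F, λ⁻¹ G)` for invertible even `λ`. -/
instance setoid (A : SuperAlg.{u} 𝕜) (n m r s : ℕ) : Setoid (MvPair A n m r s) where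
  r x y := ∃ c : A.Evenˣ, y.F = x.F.smul c ∧ y.G = x.G.smul (c⁻¹ : A.Evenˣ)
  iseqv :=
    { refl := fun x => ⟨1, by simp [RatClass.one_smul], by simp [RatClass.one_smul]⟩
      symm := by
        rintro x y ⟨c, h1, h2⟩
        refine ⟨c⁻¹, ?_, ?_⟩
        · rw [h1, ← RatClass.mul_smul, Units.inv_mul, RatClass.one_smul]
        · rw [h2, ← RatClass.mul_smul, inv_inv, Units.mul_inv, RatClass.one_smul]
      trans := by
        rintro x y z ⟨c, h1, h2⟩ ⟨d, h3, h4⟩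
        refine ⟨d * c, ?_, ?_⟩
        · rw [h3, h1, ← RatClass.mul_smul, Units.val_mul]
        · rw [h4, h2, ← RatClass.mul_smul, ← Units.val_mul, mul_inv] }

theorem map_rel (φ : A ⟶ B) {x y : MvPair A n m r s} (h : x ≈ y) : x.map φ ≈ y.map φ := by
  obtain ⟨c, h1, h2⟩ := h
  refine ⟨Units.map (SuperAlg.even φ : A.Even →* B.Even) c, ?_, ?_⟩
  · change y.F.map φ = _
    rw [h1, RatClass.map_smul]; rfl
  · change y.G.map φ = _
    rw [h2, RatClass.map_smul, ← map_inv]; rfl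

end MvPair

/-- The weighted projective superspace `P_{1,-1}(Λ^{r|s}(V) ⊕ Λ^{s|r}(ΠV))`, `dim V = n|m`,
through its functor of points. -/
noncomputable def weightedProj (𝕜 : Type u) [Field 𝕜] (n m r s : ℕ) :
    SuperAlg.{u} 𝕜 ⥤ Type (u + 1) where
  obj A := Quotient (MvPair.setoid A n m r s)
  map φ := TypeCat.ofHom (Quotient.map (MvPair.map φ) fun _ _ h => MvPair.map_rel φ h)
  map_id A := by
    ext x
    induction x using Quotient.inductionOn with | _ x
    exact congrArg _ (MvPair.ext (RatClass.map_id _) (RatClass.map_id _))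
  map_comp φ ψ := by
    ext x
    induction x using Quotient.inductionOn with | _ x
    exact congrArg _ (MvPair.ext (RatClass.map_comp _ _ _) (RatClass.map_comp _ _ _))

/-! ### The Plücker transforms -/

section Pluecker

variable {𝕜 : Type u} [Field 𝕜] {A B : SuperAlg.{u} 𝕜} {n m r s : ℕ}

/-- The determinant of the odd-odd block of `U P`, modulo products of odd variables. -/
noncomputable def plDen (U : SMat A r s n m) : MvPolynomial (EvenCoord n m r s) A.Even :=
  Matrix.det (Matrix.of fun i j : Fin s =>
    ∑ k : Fin m, MvPolynomial.C (U.b11 i k) * MvPolynomial.X (Sum.inr (k, j)))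

theorem eval₂_plDen (U : SMat A r s n m) (φ : A ⟶ B) (x : EvenCoord n m r s → B.Even) :
    (plDen U).eval₂ (SuperAlg.even φ) x =
      Matrix.det (Matrix.of fun i j : Fin s =>
        ∑ k : Fin m, (U.map φ).b11 i k * x (Sum.inr (k, j))) := by
  rw [← MvPolynomial.coe_eval₂Hom, plDen, RingHom.map_det]
  congr 1
  ext i j
  simp [SMat.map_b11]

theorem isUnit_plDen_iff (U : SMat A r s n m) (φ : A ⟶ B) (P : SMat B n m r s) :
    IsUnit ((plDen U).eval₂ (SuperAlg.even φ) P.coord) ↔ IsUnit ((U.map φ).mul P).b11.det := by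
  rw [eval₂_plDen, SMat.isUnit_det_b11_mul]
  rfl

theorem unitContent_plDen (U : Frame A n m r s) : UnitContent (plDen U.mat) := by
  obtain ⟨a, μ, h⟩ := U.rank
  refine UnitContent.of_isUnit_eval
    (Sum.elim (fun _ => 0) fun x => if x.1 = μ x.2 then 1 else 0) ?_
  have e := eval₂_plDen U.mat (𝟙 A) (Sum.elim (fun _ => 0) fun x => if x.1 = μ x.2 then 1 else 0)
  rw [SuperAlg.even_id] at e
  change IsUnit ((plDen U.mat).eval₂ (RingHom.id _) _)
  rw [e]
  convert h.isUnit_det_b11 using 2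
  ext i j
  simp [SMat.map_id, SMat.b11, SMat.cols]

/-- The Plücker transform of `U`: the rational function `pl(U)(P) = Ber (U P)`, defined where the
odd-odd block of `U P` is invertible. -/
noncomputable def pl (U : Frame A n m r s) : RatFun A n m r s where
  den := plDen U.mat
  den_unitContent := unitContent_plDen U
  val φ P := ((U.mat.map φ).mul P).ber
  natural φ ψ P h := by
    rw [isUnit_plDen_iff] at h
    rw [← SuperAlg.coe_even, ← SMat.ber_map ψ _ h, SMat.map_mul, SMat.map_comp]

/-- The `Π`-dual Plücker transform of `U`, i.e. the Plücker transform of the basis of `ΠL ⊂ ΠV`: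
the rational function `pl*(U)(P) = Ber* (U P)`, as a function of the parity reversed matrix. -/
noncomputable def plStar (U : Frame A n m r s) : RatFun A m n s r := pl U.pi

theorem plStar_val (U : Frame A n m r s) (φ : A ⟶ B) (P : SMat B n m r s) :
    (plStar U).val φ P.pi = (((U.mat.map φ).mul P).berStar : B.Even) := by
  rw [SMat.berStar, SMat.pi_mul]
  rfl

end Pluecker

/-! Everything rests on two properties of the Berezinian. It is multiplicative (`ber_mul`), and
Ber(g^Π) is inverse to Ber g (`ber_mul_ber_pi`). Hence replacing U by gU multiplies pl(U) by λ = Ber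
g and pl*(U) by λ⁻¹, which is exactly the equivalence of weights 1, -1. Multiplicativity also gives
the derivatives. Where UP is invertible, put W = (UP)⁻¹U. Adding ε with ε² = 0 to the entry p_a^i
multiplies UP on the right by 1 + Wεe_a^i, so Ber(UP) is multiplied by 1 ± W_{ia}ε
(`ber_mul_addSingle`) and W_{jb} changes by -W_{ja}εW_{ib} (`inv_mul_addSingle`). The second
derivatives are thus Ber(UP) times a signed antisymmetric expression in products of two entries of
W, and the fundamental equations become a check of signs. For injectivity, W is up to sign the
logarithmic derivative of pl(U). If pl(U') = c·pl(U), then at a generic P the matrices W of U and U'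
coincide (`exists_plW_eq`). Since UP·W = U, this gives U' = GU with G = (U'P)(UP)⁻¹. Although P
lives over an extension of A, an invertible submatrix of U expresses G through U and U' alone, so G
is defined over A (`rel_of_pl_eq_smul`). Thus pl(U) up to a factor already determines L. Generic
points and increments are obtained by extending A. A polynomial of unit content is invertible at the
tautological point over a faithfully flat extension (`exists_isUnit_eval₂`), and one can adjoin an ε
of either parity that detects every element (`exists_sq_zero_extension`). The same generic points
show that pl(U) and pl*(U) are nowhere zero. These extensions are graded by the eigenspaces of a
parity involution, which is where 2 ≠ 0 enters. Finally, a natural transformation with injective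
components is an isomorphism onto its range. -/

namespace SuperAlg

variable {𝕜 : Type u} [Field 𝕜] (A : SuperAlg 𝕜)

/-- The inclusion of the even part. -/
def evenVal : A.Even →+* A.carrier where
  toFun a := a
  map_one' := rfl
  map_mul' _ _ := rfl
  map_zero' := rfl
  map_add' _ _ := rfl

variable {A}

theorem mul_comm_of_odd {a b : A.carrier} (ha : a ∈ A.gr 1) (hb : b ∈ A.gr 1) :
    a * b = -(b * a) := by
  simpa [ZMod.val_one] using A.comm ha hb

theorem mul_comm_of_even {a b : A.carrier} {i : ZMod 2} (ha : a ∈ A.gr 0) (hb : b ∈ A.gr i) :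
    a * b = b * a := by
  simpa using A.comm ha hb

end SuperAlg

/-- The determinants agree in the quotient by the nilradical, and a unit plus a nilpotent is a unit.
Products of odd elements being nilpotent, this disposes of all odd contributions to invertibility.
-/
theorem isUnit_det_of_sub_mem_nilradical {ι R : Type*} [Fintype ι] [DecidableEq ι] [CommRing R]
    {K L : Matrix ι ι R} (h : ∀ i j, K i j - L i j ∈ nilradical R) (hL : IsUnit L.det) :
    IsUnit K.det := by
  have h1 : K.det - L.det ∈ nilradical R := by
    rw [← Ideal.Quotient.eq, RingHom.map_det, RingHom.map_det]
    congr 1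
    ext i j
    exact Ideal.Quotient.eq.mpr (h i j)
  have h2 := (mem_nilradical.mp h1).isUnit_add_left_of_commute hL (Commute.all _ _)
  simpa using h2

/-! ### Products of odd matrices -/

section OddMatrix

open SuperAlg

variable {𝕜 : Type u} [Field 𝕜] {A : SuperAlg 𝕜}

/-- Rectangular matrices with odd entries. -/
def OddMatrix (A : SuperAlg 𝕜) (ι κ : Type*) : AddSubgroup (Matrix ι κ A.carrier) where
  carrier := {B | ∀ i j, B i j ∈ A.gr 1}
  zero_mem' _ _ := Submodule.zero_mem _
  add_mem' h h' i j := Submodule.add_mem _ (h i j) (h' i j)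
  neg_mem' h i j := Submodule.neg_mem _ (h i j)

variable {ι κ l : Type*}

/-- A matrix with entries in the even part, as a matrix over the superalgebra. -/
def evenMat (M : Matrix ι κ A.Even) : Matrix ι κ A.carrier := M.map A.evenVal

theorem evenMat_injective : Function.Injective (evenMat : Matrix ι κ A.Even → _) :=
  fun _ _ h => by
    ext i j
    exact congrFun (congrFun h i) j

theorem evenMat_mul [Fintype κ] (M : Matrix ι κ A.Even) (N : Matrix κ l A.Even) :
    evenMat (M * N) = evenMat M * evenMat N := Matrix.map_mul

theorem evenMat_add (M N : Matrix ι κ A.Even) : evenMat (M + N) = evenMat M + evenMat N := rfl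

theorem evenMat_sub (M N : Matrix ι κ A.Even) : evenMat (M - N) = evenMat M - evenMat N := rfl

theorem evenMat_one [DecidableEq ι] : evenMat (1 : Matrix ι ι A.Even) = 1 :=
  Matrix.map_one _ (map_zero _) (map_one _)

/-- The product of two odd matrices has even entries. -/
def oddMul [Fintype κ] (B : Matrix ι κ A.carrier) (C : Matrix κ l A.carrier)
    (hB : B ∈ OddMatrix A ι κ)
    (hC : C ∈ OddMatrix A κ l) : Matrix ι l A.Even :=
  Matrix.of fun i j => ⟨(B * C) i j, by
    rw [Matrix.mul_apply]
    exact Submodule.sum_mem _ fun k _ => A.mul_mem_gr (hB i k) (hC k j) (by decide)⟩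

theorem evenMat_oddMul [Fintype κ] (B : Matrix ι κ A.carrier) (C : Matrix κ l A.carrier)
    (hB : B ∈ OddMatrix A ι κ) (hC : C ∈ OddMatrix A κ l) :
    evenMat (oddMul B C hB hC) = B * C := rfl

theorem even_mul_odd [Fintype κ] {M : Matrix ι κ A.Even}
    {C : Matrix κ l A.carrier}
    (hC : C ∈ OddMatrix A κ l) : evenMat M * C ∈ OddMatrix A ι l := fun i j => by
  rw [Matrix.mul_apply]
  exact Submodule.sum_mem _ fun k _ => A.mul_mem_gr (M i k).2 (hC k j) (by decide)

theorem odd_mul_even [Fintype κ] {B : Matrix ι κ A.carrier} {M : Matrix κ l A.Even}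
    (hB : B ∈ OddMatrix A ι κ) : B * evenMat M ∈ OddMatrix A ι l := fun i j => by
  rw [Matrix.mul_apply]
  exact Submodule.sum_mem _ fun k _ => A.mul_mem_gr (hB i k) (M k j).2 (by decide)

theorem oddMul_mem_nilradical [Fintype κ] (B : Matrix ι κ A.carrier) (C : Matrix κ l A.carrier)
    (hB : B ∈ OddMatrix A ι κ) (hC : C ∈ OddMatrix A κ l) (i : ι) (j : l) :
    oddMul B C hB hC i j ∈ nilradical A.Even := by
  have e : oddMul B C hB hC i j = ∑ k, (⟨B i k * C k j,
      A.mul_mem_gr (hB i k) (hC k j) (by decide)⟩ : A.Even) := by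
    refine Subtype.ext ?_
    rw [AddSubmonoidClass.coe_finsetSum]
    exact Matrix.mul_apply
  rw [e]
  exact Ideal.sum_mem _ fun k _ => mem_nilradical.mpr
    (SMat.isNilpotent_of_odd_mul A _ _ _ (hB i k) (hC k j) rfl)

variable [Fintype ι] [DecidableEq ι] [Fintype κ]

theorem isUnit_det_one_add_oddMul (B : Matrix ι κ A.carrier) (C : Matrix κ ι A.carrier)
    (hB : B ∈ OddMatrix A ι κ) (hC : C ∈ OddMatrix A κ ι) :
    IsUnit (1 + oddMul B C hB hC).det :=
  isUnit_det_of_sub_mem_nilradical (L := 1)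
    (fun i j => by
      rw [Matrix.add_apply, add_sub_cancel_left]
      exact oddMul_mem_nilradical B C hB hC i j) (by simp)

theorem evenMat_mul_inv {M : Matrix ι ι A.Even} (h : IsUnit M.det) :
    evenMat M * evenMat M⁻¹ = 1 := by
  rw [← evenMat_mul, Matrix.mul_nonsing_inv _ h, evenMat_one]

theorem evenMat_inv_mul {M : Matrix ι ι A.Even} (h : IsUnit M.det) :
    evenMat M⁻¹ * evenMat M = 1 := by
  rw [← evenMat_mul, Matrix.nonsing_inv_mul _ h, evenMat_one]

/-- The added matrix is a column times a row, so the determinant of a rank one perturbation of the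
identity applies. -/
theorem det_one_add_row {R : Type*} [CommRing R] (i : ι) (v : ι → R) :
    (1 + Matrix.of fun k l => if k = i then v l else 0 : Matrix ι ι R).det = 1 + v i := by
  have e : (Matrix.of fun k l => if k = i then v l else 0 : Matrix ι ι R) =
      Matrix.replicateCol Unit (Pi.single i (1 : R)) * Matrix.replicateRow Unit v := by
    ext k l
    simp [Matrix.mul_apply, Pi.single_apply]
  rw [e, Matrix.det_one_add_replicateCol_mul_replicateRow]
  simp

theorem det_one_add_col {R : Type*} [CommRing R] (i : ι) (v : ι → R) :
    (1 + Matrix.of fun k l => if l = i then v k else 0 : Matrix ι ι R).det = 1 + v i := by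
  rw [← det_one_add_row i v, ← Matrix.det_transpose]
  congr 1
  ext k l
  simp [Matrix.one_apply, eq_comm]

/-- For odd matrices, `det (1 + B C)` and `det (1 + C B)` are inverse to each other. -/
theorem det_one_add_oddMul_mul_det [DecidableEq κ] (B : Matrix ι κ A.carrier)
    (hB : B ∈ OddMatrix A ι κ) :
    ∀ (C : Matrix κ ι A.carrier) (hC : C ∈ OddMatrix A κ ι),
      (1 + oddMul B C hB hC).det * (1 + oddMul C B hC hB).det = 1 := by
  -- Induction on the set of entries of B that are kept. The statement is for all C at once because
  -- adding an entry replaces C by C T⁻¹.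
  have key : ∀ s : Finset (ι × κ), ∀ (B' : Matrix ι κ A.carrier) (hB' : B' ∈ OddMatrix A ι κ),
      B' = ∑ x ∈ s, Matrix.single x.1 x.2 (B x.1 x.2) →
      ∀ (C : Matrix κ ι A.carrier) (hC : C ∈ OddMatrix A κ ι),
        (1 + oddMul B' C hB' hC).det * (1 + oddMul C B' hC hB').det = 1 := by
    intro s
    induction s using Finset.induction_on with
    | empty =>
      intro B' hB' e C hC
      rw [Finset.sum_empty] at e
      subst e
      have e1 : oddMul 0 C hB' hC = 0 := evenMat_injective (by
        rw [evenMat_oddMul, Matrix.zero_mul]; ext; rfl)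
      have e2 : oddMul C 0 hC hB' = 0 := evenMat_injective (by
        rw [evenMat_oddMul, Matrix.mul_zero]; ext; rfl)
      rw [e1, e2]
      simp
    | insert x s hx ih =>
      intro B' hB' e C hC
      rw [Finset.sum_insert hx, add_comm] at e
      have hB2 : Matrix.single x.1 x.2 (B x.1 x.2) ∈ OddMatrix A ι κ := fun i j => by
        by_cases h : x.1 = i ∧ x.2 = j
        · rw [← h.1, ← h.2, Matrix.single_apply_same]; exact hB _ _
        · rw [Matrix.single_apply_of_ne _ _ _ _ _ h]; exact Submodule.zero_mem _
      set B1 := ∑ x ∈ s, Matrix.single x.1 x.2 (B x.1 x.2) with hB1'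
      set B2 := Matrix.single x.1 x.2 (B x.1 x.2) with hB2'
      have hB1 : B1 ∈ OddMatrix A ι κ := by
        rw [eq_sub_of_add_eq e.symm]; exact sub_mem hB' hB2
      -- For a single entry b only one entry c of C matters: the determinants are 1 + bc and 1 + cb,
      -- where cb = -bc and (bc)² = 0.
      have single : ∀ (C : Matrix κ ι A.carrier) (hC : C ∈ OddMatrix A κ ι),
          (1 + oddMul B2 C hB2 hC).det * (1 + oddMul C B2 hC hB2).det = 1 := by
        intro C hC
        let b := B x.1 x.2
        have hb : b ∈ A.gr 1 := hB _ _
        have e1 : oddMul B2 C hB2 hC = Matrix.of fun k l => if k = x.1 then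
            (⟨b * C x.2 l, A.mul_mem_gr hb (hC _ _) (by decide)⟩ : A.Even) else 0 := by
          refine evenMat_injective ?_
          rw [evenMat_oddMul]
          ext k l
          by_cases h : k = x.1
          · subst h
            rw [hB2', Matrix.single_mul_apply_same]
            simp only [evenMat, Matrix.map_apply, Matrix.of_apply, if_true]
            rfl
          · rw [hB2', Matrix.single_mul_apply_of_ne _ _ _ _ _ h]
            simp [evenMat, h]
        have e2 : oddMul C B2 hC hB2 = Matrix.of fun k l => if l = x.2 then
            (⟨C k x.1 * b, A.mul_mem_gr (hC _ _) hb (by decide)⟩ : A.Even) else 0 := by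
          refine evenMat_injective ?_
          rw [evenMat_oddMul]
          ext k l
          by_cases h : l = x.2
          · subst h
            rw [hB2', Matrix.mul_single_apply_same]
            simp only [evenMat, Matrix.map_apply, Matrix.of_apply, if_true]
            rfl
          · rw [hB2', Matrix.mul_single_apply_of_ne _ _ _ _ _ h]
            simp [evenMat, h]
        rw [e1, e2, det_one_add_row, det_one_add_col]
        refine Subtype.ext ?_
        change (1 + b * C x.2 x.1) * (1 + C x.2 x.1 * b) = 1
        have h1 := mul_comm_of_odd (hC x.2 x.1) hb
        have h2 : b * C x.2 x.1 * (b * C x.2 x.1) = 0 := by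
          rw [mul_assoc, ← mul_assoc (C x.2 x.1), h1, neg_mul, mul_assoc, A.odd_sq (hC _ _)]
          simp
        rw [h1, mul_add, mul_one, mul_neg, add_mul, h2]
        simp
      have u1 := isUnit_det_one_add_oddMul B1 C hB1 hC
      set T := 1 + oddMul B1 C hB1 hC with hT
      have hC' : C * evenMat T⁻¹ ∈ OddMatrix A κ ι := odd_mul_even hC
      -- With T = 1 + B₁C, splitting B' = B₁ + B₂ gives 1 + B'C = (1 + B₂CT⁻¹)T, and 1 + CB' = (1 +
      -- CB₁)(1 + CT⁻¹B₂) because (1 + CB₁)C = CT. The determinants then pair off into the induction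
      -- hypothesis and the one-entry case.
      have f1 : 1 + oddMul B' C hB' hC =
          (1 + oddMul B2 (C * evenMat T⁻¹) hB2 hC') * T := by
        refine evenMat_injective ?_
        rw [evenMat_mul, evenMat_add, evenMat_add, evenMat_one, evenMat_oddMul, evenMat_oddMul,
          add_mul, one_mul, Matrix.mul_assoc, Matrix.mul_assoc, evenMat_inv_mul u1, hT,
          evenMat_add, evenMat_one, evenMat_oddMul, Matrix.mul_one, e, Matrix.add_mul, add_assoc]
      have f2 : 1 + oddMul C B' hC hB' =
          (1 + oddMul C B1 hC hB1) * (1 + oddMul (C * evenMat T⁻¹) B2 hC' hB2) := by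
        refine evenMat_injective ?_
        have : (1 + C * B1) * C = C * (1 + B1 * C) := by
          rw [Matrix.add_mul, Matrix.mul_add, Matrix.mul_one, Matrix.one_mul, Matrix.mul_assoc]
        have h3 : evenMat T = 1 + B1 * C := by rw [hT, evenMat_add, evenMat_one, evenMat_oddMul]
        rw [evenMat_mul, evenMat_add, evenMat_add, evenMat_add, evenMat_one, evenMat_oddMul,
          evenMat_oddMul, evenMat_oddMul, mul_add, mul_one, ← Matrix.mul_assoc,
          ← Matrix.mul_assoc, this, ← h3, Matrix.mul_assoc C, evenMat_mul_inv u1, e,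
          Matrix.mul_add, Matrix.mul_one, add_assoc]
      rw [f1, f2, Matrix.det_mul, Matrix.det_mul]
      have h1 := ih B1 hB1 rfl C hC
      have h2 := single _ hC'
      rw [← hT] at h1
      linear_combination h1 * (1 + oddMul B2 (C * evenMat T⁻¹) hB2 hC').det *
        (1 + oddMul (C * evenMat T⁻¹) B2 hC' hB2).det + h2
  refine key Finset.univ B hB ?_
  rw [← Finset.univ_product_univ, Finset.sum_product]
  exact Matrix.matrix_eq_sum_single B

end OddMatrix

/-! ### Triangular factorization and multiplicativity of the Berezinian -/

namespace SMat

open SuperAlg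

variable {𝕜 : Type u} [Field 𝕜] {A A' : SuperAlg 𝕜} {p q p' q' : ℕ}

theorem evenMat_b00 (g : SMat A p q p' q') : evenMat g.b00 = g.val.toBlocks₁₁ := rfl

theorem evenMat_b11 (g : SMat A p q p' q') : evenMat g.b11 = g.val.toBlocks₂₂ := rfl

theorem odd01 (g : SMat A p q p' q') : g.val.toBlocks₁₂ ∈ OddMatrix A (Fin p) (Fin q') :=
  fun i j => g.mem (Sum.inl i) (Sum.inr j)

theorem odd10 (g : SMat A p q p' q') : g.val.toBlocks₂₁ ∈ OddMatrix A (Fin q) (Fin p') :=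
  fun i j => g.mem (Sum.inr i) (Sum.inl j)

theorem val_eq_fromBlocks (g : SMat A p q p' q') : g.val =
    Matrix.fromBlocks (evenMat g.b00) g.val.toBlocks₁₂ g.val.toBlocks₂₁ (evenMat g.b11) :=
  (Matrix.fromBlocks_toBlocks g.val).symm

/-- The even supermatrix with given blocks. -/
def ofBlocks (S : Matrix (Fin p) (Fin p) A.Even) (B : Matrix (Fin p) (Fin q) A.carrier)
    (C : Matrix (Fin q) (Fin p) A.carrier) (T : Matrix (Fin q) (Fin q) A.Even)
    (hB : B ∈ OddMatrix A (Fin p) (Fin q)) (hC : C ∈ OddMatrix A (Fin q) (Fin p)) :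
    SMat A p q p q where
  val := Matrix.fromBlocks (evenMat S) B C (evenMat T)
  mem i j := by
    rcases i with i | i <;> rcases j with j | j
    · exact (S i j).2
    · exact hB i j
    · exact hC i j
    · exact (T i j).2

theorem ofBlocks_b11 (S : Matrix (Fin p) (Fin p) A.Even) (B : Matrix (Fin p) (Fin q) A.carrier)
    (C : Matrix (Fin q) (Fin p) A.carrier) (T : Matrix (Fin q) (Fin q) A.Even) (hB hC) :
    (ofBlocks S B C T hB hC).b11 = T := rfl

/-- The upper unitriangular supermatrix with odd block `B`. -/
def upper (B : Matrix (Fin p) (Fin q) A.carrier) (hB : B ∈ OddMatrix A (Fin p) (Fin q)) :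
    SMat A p q p q := ofBlocks 1 B 0 1 hB (zero_mem _)

/-- The lower unitriangular supermatrix with odd block `C`. -/
def lower (C : Matrix (Fin q) (Fin p) A.carrier) (hC : C ∈ OddMatrix A (Fin q) (Fin p)) :
    SMat A p q p q := ofBlocks 1 0 C 1 (zero_mem _) hC

/-- The block diagonal supermatrix with blocks `S` and `T`. -/
def blockDiag (S : Matrix (Fin p) (Fin p) A.Even) (T : Matrix (Fin q) (Fin q) A.Even) :
    SMat A p q p q := ofBlocks S 0 0 T (zero_mem _) (zero_mem _)

/-! ### Products of unitriangular and block diagonal supermatrices. -/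

section Products

variable {B B' : Matrix (Fin p) (Fin q) A.carrier} {C C' : Matrix (Fin q) (Fin p) A.carrier}
  {S S' : Matrix (Fin p) (Fin p) A.Even} {T T' : Matrix (Fin q) (Fin q) A.Even}
  (hB : B ∈ OddMatrix A (Fin p) (Fin q)) (hB' : B' ∈ OddMatrix A (Fin p) (Fin q))
  (hC : C ∈ OddMatrix A (Fin q) (Fin p)) (hC' : C' ∈ OddMatrix A (Fin q) (Fin p))

theorem upper_mul_upper : (upper B hB).mul (upper B' hB') = upper (B + B') (add_mem hB hB') :=
  SMat.ext (by simp [upper, mul, ofBlocks, Matrix.fromBlocks_multiply, evenMat_one, add_comm])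

theorem lower_mul_lower : (lower C hC).mul (lower C' hC') = lower (C + C') (add_mem hC hC') :=
  SMat.ext (by simp [lower, mul, ofBlocks, Matrix.fromBlocks_multiply, evenMat_one])

theorem blockDiag_mul : (blockDiag S T).mul (blockDiag S' T') = blockDiag (S * S') (T * T') :=
  SMat.ext (by simp [blockDiag, mul, ofBlocks, Matrix.fromBlocks_multiply, evenMat_mul])

/-- Together with `lower_mul_blockDiag`, this gathers the diagonal factors in the middle of a
product of two factorizations, where their determinants can be read off. -/
theorem blockDiag_mul_upper (hT : IsUnit T.det) : (blockDiag S T).mul (upper B hB) =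
    (upper (evenMat S * B * evenMat T⁻¹) (odd_mul_even (even_mul_odd hB))).mul (blockDiag S T) :=
  SMat.ext (by simp [blockDiag, upper, mul, ofBlocks, Matrix.fromBlocks_multiply, evenMat_one,
    Matrix.mul_assoc, evenMat_inv_mul hT])

theorem lower_mul_blockDiag (hT : IsUnit T.det) : (lower C hC).mul (blockDiag S T) =
    (blockDiag S T).mul
      (lower (evenMat T⁻¹ * (C * evenMat S)) (even_mul_odd (odd_mul_even hC))) :=
  SMat.ext (by simp [blockDiag, lower, mul, ofBlocks, Matrix.fromBlocks_multiply, evenMat_one,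
    ← Matrix.mul_assoc, evenMat_mul_inv hT])

theorem upper_zero : upper (0 : Matrix (Fin p) (Fin q) A.carrier) (zero_mem _) = one A p q :=
  SMat.ext (by simp [upper, ofBlocks, evenMat_one, one])

theorem lower_zero : lower (0 : Matrix (Fin q) (Fin p) A.carrier) (zero_mem _) = one A p q :=
  SMat.ext (by simp [lower, ofBlocks, evenMat_one, one])

theorem blockDiag_one : blockDiag (1 : Matrix (Fin p) (Fin p) A.Even)
    (1 : Matrix (Fin q) (Fin q) A.Even) = one A p q :=
  SMat.ext (by simp [blockDiag, ofBlocks, evenMat_one, one])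

theorem isInv_upper : (upper B hB).IsInv := by
  refine ⟨upper (-B) (neg_mem hB), ?_, ?_⟩ <;> rw [upper_mul_upper]
  · simp only [add_neg_cancel]; exact upper_zero
  · simp only [neg_add_cancel]; exact upper_zero

theorem isInv_lower : (lower C hC).IsInv := by
  refine ⟨lower (-C) (neg_mem hC), ?_, ?_⟩ <;> rw [lower_mul_lower]
  · simp only [add_neg_cancel]; exact lower_zero
  · simp only [neg_add_cancel]; exact lower_zero

theorem isInv_blockDiag (hS : IsUnit S.det) (hT : IsUnit T.det) : (blockDiag S T).IsInv := by
  refine ⟨blockDiag S⁻¹ T⁻¹, ?_, ?_⟩ <;> rw [blockDiag_mul]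
  · rw [Matrix.mul_nonsing_inv _ hS, Matrix.mul_nonsing_inv _ hT, blockDiag_one]
  · rw [Matrix.nonsing_inv_mul _ hS, Matrix.nonsing_inv_mul _ hT, blockDiag_one]

end Products

theorem evenMat_schur (g : SMat A p q p q) : evenMat g.schur =
    evenMat g.b00 - g.val.toBlocks₁₂ * evenMat g.b11⁻¹ * g.val.toBlocks₂₁ := by
  ext i j
  simp only [Matrix.sub_apply, Matrix.mul_apply, Finset.sum_mul]
  rw [Finset.sum_comm]
  rfl

/-- The factorization of a supermatrix with invertible odd-odd block. -/
theorem factorization (g : SMat A p q p q) (hg : IsUnit g.b11.det) :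
    g = ((upper (g.val.toBlocks₁₂ * evenMat g.b11⁻¹) (odd_mul_even g.odd01)).mul
      (blockDiag g.schur g.b11)).mul
        (lower (evenMat g.b11⁻¹ * g.val.toBlocks₂₁) (even_mul_odd g.odd10)) := by
  refine SMat.ext ?_
  conv_lhs => rw [val_eq_fromBlocks g]
  simp only [upper, lower, blockDiag, mul, ofBlocks, Matrix.fromBlocks_multiply, evenMat_one,
    Matrix.one_mul, Matrix.mul_one, Matrix.mul_zero, Matrix.zero_mul, add_zero, zero_add]
  have e1 : ∀ X : Matrix (Fin p) (Fin q) A.carrier,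
      X * evenMat g.b11⁻¹ * evenMat g.b11 = X := fun X => by
    rw [Matrix.mul_assoc, evenMat_inv_mul hg, Matrix.mul_one]
  have e2 : ∀ X : Matrix (Fin q) (Fin p) A.carrier,
      evenMat g.b11 * (evenMat g.b11⁻¹ * X) = X := fun X => by
    rw [← Matrix.mul_assoc, evenMat_mul_inv hg, Matrix.one_mul]
  rw [e1, e2, evenMat_schur, ← Matrix.mul_assoc, sub_add_cancel]

section Factored

variable {B : Matrix (Fin p) (Fin q) A.carrier} {C : Matrix (Fin q) (Fin p) A.carrier}
  {S : Matrix (Fin p) (Fin p) A.Even} {T : Matrix (Fin q) (Fin q) A.Even}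
  (hB : B ∈ OddMatrix A (Fin p) (Fin q)) (hC : C ∈ OddMatrix A (Fin q) (Fin p))

theorem val_factored : (((upper B hB).mul (blockDiag S T)).mul (lower C hC)).val =
    Matrix.fromBlocks (evenMat S + B * evenMat T * C) (B * evenMat T) (evenMat T * C)
      (evenMat T) := by
  simp [upper, lower, blockDiag, mul, ofBlocks, Matrix.fromBlocks_multiply, evenMat_one]

theorem b11_factored : (((upper B hB).mul (blockDiag S T)).mul (lower C hC)).b11 = T :=
  evenMat_injective (by rw [evenMat_b11, val_factored, Matrix.toBlocks_fromBlocks₂₂])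

/-- The Schur complement of the product is (S + BTC) - (BT)T⁻¹(TC) = S. -/
theorem ber_factored (hT : IsUnit T.det) :
    (((upper B hB).mul (blockDiag S T)).mul (lower C hC)).ber = S.det * Ring.inverse T.det := by
  have h : (((upper B hB).mul (blockDiag S T)).mul (lower C hC)).schur = S := by
    refine evenMat_injective ?_
    rw [evenMat_schur, b11_factored, evenMat_b00, val_factored, Matrix.toBlocks_fromBlocks₁₁,
      Matrix.toBlocks_fromBlocks₁₂, Matrix.toBlocks_fromBlocks₂₁,
      Matrix.mul_assoc B (evenMat T) (evenMat T⁻¹),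
      evenMat_mul_inv hT, Matrix.mul_one, ← Matrix.mul_assoc, add_sub_cancel_right]
  rw [ber, h, b11_factored]

theorem ber_blockDiag (hT : IsUnit T.det) :
    (blockDiag S T).ber = S.det * Ring.inverse T.det := by
  have := ber_factored (S := S) (zero_mem _ : (0 : Matrix (Fin p) (Fin q) A.carrier) ∈ _)
    (zero_mem _ : (0 : Matrix (Fin q) (Fin p) A.carrier) ∈ _) hT
  rwa [upper_zero, lower_zero, one_mul', mul_one'] at this

/-- The factorization of the product of a lower and an upper unitriangular supermatrix. -/
theorem lower_mul_upper : ∃ (B' : Matrix (Fin p) (Fin q) A.carrier) (hB' : B' ∈ OddMatrix A _ _)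
    (C' : Matrix (Fin q) (Fin p) A.carrier) (hC' : C' ∈ OddMatrix A _ _)
    (S : Matrix (Fin p) (Fin p) A.Even) (T : Matrix (Fin q) (Fin q) A.Even),
    IsUnit T.det ∧ S.det * Ring.inverse T.det = 1 ∧ (lower C hC).mul (upper B hB) =
      ((upper B' hB').mul (blockDiag S T)).mul (lower C' hC') := by
  set g := (lower C hC).mul (upper B hB) with hg
  have hv : g.val = Matrix.fromBlocks 1 B C (1 + C * B) := by
    simp [hg, upper, lower, mul, ofBlocks, Matrix.fromBlocks_multiply, evenMat_one, add_comm]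
  have h11 : g.b11 = 1 + oddMul C B hC hB := evenMat_injective (by
    rw [evenMat_b11, hv, Matrix.toBlocks_fromBlocks₂₂, evenMat_add, evenMat_one, evenMat_oddMul])
  have h00 : g.b00 = 1 := evenMat_injective (by
    rw [evenMat_b00, hv, Matrix.toBlocks_fromBlocks₁₁, evenMat_one])
  have hT : IsUnit g.b11.det := by rw [h11]; exact isUnit_det_one_add_oddMul C B hC hB
  refine ⟨_, _, _, _, _, _, hT, ?_, factorization g hT⟩
  -- The Schur complement here is 1 - B(1 + CB)⁻¹C, the inverse of 1 + BC, since C(1 + BC) = (1 +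
  -- CB)C.
  have hs : g.schur * (1 + oddMul B C hB hC) = 1 := by
    refine evenMat_injective ?_
    rw [evenMat_mul, evenMat_schur, h00, hv, Matrix.toBlocks_fromBlocks₁₂,
      Matrix.toBlocks_fromBlocks₂₁, evenMat_add, evenMat_one, evenMat_oddMul]
    have e : C * (1 + B * C) = evenMat g.b11 * C := by
      rw [h11, evenMat_add, evenMat_one, evenMat_oddMul, Matrix.mul_add, Matrix.add_mul,
        Matrix.mul_one, Matrix.one_mul, Matrix.mul_assoc]
    rw [Matrix.sub_mul, Matrix.one_mul, Matrix.mul_assoc (B * _), e, Matrix.mul_assoc B,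
      ← Matrix.mul_assoc (evenMat g.b11⁻¹), evenMat_inv_mul hT, Matrix.one_mul,
      add_sub_cancel_right]
  have h1 := congrArg Matrix.det hs
  rw [Matrix.det_mul, Matrix.det_one] at h1
  have h2 := det_one_add_oddMul_mul_det B hB C hC
  -- Both determinants are inverse to det(1 + BC): one by `hs`, the other by the identity for odd
  -- matrices. Hence the Berezinian is 1.
  have h3 : g.schur.det = g.b11.det := by
    rw [h11]
    linear_combination (-g.schur.det) * h2 + (1 + oddMul C B hC hB).det * h1
  rw [h3, Ring.mul_inverse_cancel _ hT]

end Factored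

/-- The Berezinian is multiplicative. -/
theorem ber_mul {g h : SMat A p q p q} (hg : IsUnit g.b11.det) (hh : IsUnit h.b11.det) :
    (g.mul h).ber = g.ber * h.ber := by
  -- Writing g = u d l and h = u' d' l', only the inner product l u' is in the wrong order. It is
  -- refactored with a diagonal part of Berezinian 1, after which the whole product is again upper
  -- times diagonal times lower.
  obtain ⟨B, hB, C, hC, S, T, hT, e1, e2⟩ := lower_mul_upper
    (odd_mul_even h.odd01 : h.val.toBlocks₁₂ * evenMat h.b11⁻¹ ∈ OddMatrix A _ _)
    (even_mul_odd g.odd10 : evenMat g.b11⁻¹ * g.val.toBlocks₂₁ ∈ OddMatrix A _ _)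
  have e : g.mul h = _ := congrArg₂ SMat.mul (factorization g hg) (factorization h hh)
  have reassoc : ∀ u d l u' d' l' : SMat A p q p q, ((u.mul d).mul l).mul ((u'.mul d').mul l') =
      ((u.mul d).mul (l.mul u')).mul (d'.mul l') := fun u d l u' d' l' => by
    simp only [mul_assoc']
  have reassoc' : ∀ u d u' d' l' d'' l'' : SMat A p q p q,
      ((u.mul d).mul ((u'.mul d').mul l')).mul (d''.mul l'') =
      (u.mul (d.mul u')).mul (d'.mul ((l'.mul d'').mul l'')) := fun u d u' d' l' d'' l'' => by
    simp only [mul_assoc']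
  have reassoc'' : ∀ u u' d d' d'' l' l'' : SMat A p q p q,
      (u.mul (u'.mul d)).mul (d'.mul ((d''.mul l').mul l'')) =
      ((u.mul u').mul ((d.mul d').mul d'')).mul (l'.mul l'') := fun u u' d d' d'' l' l'' => by
    simp only [mul_assoc']
  rw [reassoc, e2, reassoc', blockDiag_mul_upper _ hg, lower_mul_blockDiag _ hh, reassoc'',
    upper_mul_upper, lower_mul_lower, blockDiag_mul, blockDiag_mul] at e
  rw [e, ber_factored _ _ (by
    rw [Matrix.det_mul, Matrix.det_mul]; exact (hg.mul hT).mul hh), ber, ber, Matrix.det_mul,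
    Matrix.det_mul, Matrix.det_mul, Matrix.det_mul, Ring.mul_inverse_rev, Ring.mul_inverse_rev]
  linear_combination g.schur.det * h.schur.det * Ring.inverse g.b11.det *
    Ring.inverse h.b11.det * e1

theorem IsInv.isUnit_det_b00 {g : SMat A p q p q} (hg : g.IsInv) : IsUnit g.b00.det :=
  hg.pi.isUnit_det_b11

/-- The correction term is a product of two odd matrices, hence has nilpotent entries. This is so
for any even matrix in the place of `g.b11⁻¹`, so the odd-odd block need not be invertible. -/
theorem isUnit_det_schur {g : SMat A p q p q} (h0 : IsUnit g.b00.det) : IsUnit g.schur.det := by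
  refine isUnit_det_of_sub_mem_nilradical (fun i j => ?_) h0
  have e : g.schur - g.b00 = -oddMul (g.val.toBlocks₁₂ * evenMat g.b11⁻¹) g.val.toBlocks₂₁
      (odd_mul_even g.odd01) g.odd10 := evenMat_injective (by
    rw [evenMat_sub, evenMat_schur, sub_sub_cancel_left]; rfl)
  rw [← Matrix.sub_apply, e]
  exact neg_mem (oddMul_mem_nilradical _ _ _ _ i j)

/-- An even supermatrix is invertible if and only if its diagonal blocks are. -/
theorem isInv_iff {g : SMat A p q p q} : g.IsInv ↔ IsUnit g.b00.det ∧ IsUnit g.b11.det := by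
  refine ⟨fun h => ⟨h.isUnit_det_b00, h.isUnit_det_b11⟩, fun ⟨h0, h1⟩ => ?_⟩
  rw [factorization g h1]
  exact ((isInv_upper _).mul (isInv_blockDiag (isUnit_det_schur h0) h1)).mul (isInv_lower _)

theorem isUnit_ber {g : SMat A p q p q} (hg : g.IsInv) : IsUnit g.ber :=
  (isUnit_det_schur hg.isUnit_det_b00).mul hg.isUnit_det_b11.ringInverse

theorem pi_ofBlocks (S : Matrix (Fin p) (Fin p) A.Even) (B : Matrix (Fin p) (Fin q) A.carrier)
    (C : Matrix (Fin q) (Fin p) A.carrier) (T : Matrix (Fin q) (Fin q) A.Even) (hB hC) :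
    (ofBlocks S B C T hB hC).pi = ofBlocks T C B S hC hB :=
  SMat.ext (Matrix.fromBlocks_submatrix_sum_swap_sum_swap _ _ _ _)

/-- `Ber (g^Π)` is inverse to `Ber g`. -/
theorem ber_mul_ber_pi {g : SMat A p q p q} (hg : g.IsInv) : g.ber * g.pi.ber = 1 := by
  have h1 := hg.isUnit_det_b11
  have hs := isUnit_det_schur hg.isUnit_det_b00
  have one1 : ∀ n : ℕ, IsUnit (1 : Matrix (Fin n) (Fin n) A.Even).det := fun n => by simp
  -- Parity reversion turns the factorization into lower times diagonal times upper, with the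
  -- diagonal blocks exchanged. Multiplicativity reduces the Berezinian to that of the diagonal
  -- factor, the unitriangular ones having Berezinian 1.
  have e : g.pi.ber = g.b11.det * Ring.inverse g.schur.det := by
    conv_lhs => rw [factorization g h1, pi_mul, pi_mul]
    have hu : ∀ (B : Matrix (Fin p) (Fin q) A.carrier) (hB),
        (upper B hB).pi.b11 = 1 := fun B hB => by rw [upper, pi_ofBlocks, ofBlocks_b11]
    have hl : ∀ (C : Matrix (Fin q) (Fin p) A.carrier) (hC),
        (lower C hC).pi.b11 = 1 := fun C hC => by rw [lower, pi_ofBlocks, ofBlocks_b11]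
    have hd : (blockDiag g.schur g.b11).pi = blockDiag g.b11 g.schur := by
      rw [blockDiag, pi_ofBlocks, blockDiag]
    have bu : ∀ (B : Matrix (Fin p) (Fin q) A.carrier) (hB),
        (upper B hB).pi.ber = 1 := fun B hB => by
      rw [upper, pi_ofBlocks, ← lower]
      have := ber_factored (S := (1 : Matrix _ _ A.Even)) (zero_mem _) hB (one1 p)
      rw [upper_zero, blockDiag_one, one_mul', one_mul'] at this
      simpa using this
    have bl : ∀ (C : Matrix (Fin q) (Fin p) A.carrier) (hC),
        (lower C hC).pi.ber = 1 := fun C hC => by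
      rw [lower, pi_ofBlocks, ← upper]
      have := ber_factored (S := (1 : Matrix _ _ A.Even)) hC (zero_mem _) (one1 p)
      rw [lower_zero, blockDiag_one, mul_one', mul_one'] at this
      simpa using this
    rw [ber_mul, ber_mul, bu, bl, hd, ber_blockDiag hs, one_mul, mul_one]
    · rw [hu]; exact one1 p
    · rw [hd]; exact hs
    · exact ((isInv_upper _).pi.mul (isInv_blockDiag hs h1).pi).isUnit_det_b11
    · rw [hl]; exact one1 p
  rw [e, ber]
  linear_combination (Ring.inverse g.b11.det * g.b11.det) * Ring.mul_inverse_cancel _ hs +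
    Ring.inverse_mul_cancel _ h1

/-! ### The inverse matrix -/

open Classical in
/-- The inverse of an even supermatrix (the matrix itself if it is not invertible). -/
noncomputable def inv (g : SMat A p q p q) : SMat A p q p q :=
  if h : g.IsInv then h.choose else g

theorem mul_inv {g : SMat A p q p q} (hg : g.IsInv) : g.mul g.inv = one A p q := by
  rw [inv, dif_pos hg]; exact hg.choose_spec.1

theorem inv_mul {g : SMat A p q p q} (hg : g.IsInv) : g.inv.mul g = one A p q := by
  rw [inv, dif_pos hg]; exact hg.choose_spec.2

theorem IsInv.inv {g : SMat A p q p q} (hg : g.IsInv) : g.inv.IsInv :=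
  ⟨g, inv_mul hg, mul_inv hg⟩

theorem inv_mul_cancel {g : SMat A p q p q} (hg : g.IsInv) (M : SMat A p q p' q') :
    g.inv.mul (g.mul M) = M := by rw [← mul_assoc', inv_mul hg, one_mul']

theorem mul_inv_cancel {g : SMat A p q p q} (hg : g.IsInv) (M : SMat A p q p' q') :
    g.mul (g.inv.mul M) = M := by rw [← mul_assoc', mul_inv hg, one_mul']

theorem eq_inv_of_mul_eq_one {g h : SMat A p q p q} (hg : g.IsInv) (e : g.mul h = one A p q) :
    h = g.inv := by rw [← inv_mul_cancel hg h, e, mul_one']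

theorem map_inv (φ : A ⟶ A') {g : SMat A p q p q} (hg : g.IsInv) :
    (g.map φ).inv = g.inv.map φ :=
  (eq_inv_of_mul_eq_one (hg.map φ) (by rw [← map_mul, mul_inv hg, map_one])).symm

theorem inv_mul_rev {g h : SMat A p q p q} (hg : g.IsInv) (hh : h.IsInv) :
    (g.mul h).inv = h.inv.mul g.inv :=
  (eq_inv_of_mul_eq_one (hg.mul hh) (by rw [mul_assoc', mul_inv_cancel hh, mul_inv hg])).symm

/-- A factor of an invertible square supermatrix is invertible. -/
theorem isInv_of_mul {g h : SMat A p q p q} (hgh : (g.mul h).IsInv) : g.IsInv := by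
  rw [isInv_iff]
  -- Modulo nilpotents the odd-odd block is multiplicative, and after parity reversion so is the
  -- even-even one. Both diagonal blocks of g are therefore left factors of matrices with unit
  -- determinant.
  have h1 := (isUnit_det_b11_mul g h).mp hgh.isUnit_det_b11
  have h0 := hgh.pi
  rw [pi_mul] at h0
  have h0 := (isUnit_det_b11_mul g.pi h.pi).mp h0.isUnit_det_b11
  rw [Matrix.det_mul] at h0 h1
  exact ⟨isUnit_of_mul_isUnit_left h0, isUnit_of_mul_isUnit_left h1⟩

end SMat

/-! ### Partial derivatives of the Plücker transform -/

namespace SMat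

open SuperAlg

variable {𝕜 : Type u} [Field 𝕜] {A A' : SuperAlg 𝕜} {p q p' q' n m r s : ℕ}

/-- Moving ε past a homogeneous w costs only a sign. This kills all terms quadratic in ε, for even
and odd ε alike. -/
theorem mul_mul_self_eq_zero {i j : ZMod 2} {ε w : A.carrier} (hε : ε ∈ A.gr i) (hw : w ∈ A.gr j)
    (h0 : ε * ε = 0) : ε * w * ε = 0 := by
  rw [A.comm hε hw, mul_assoc, mul_assoc, h0, mul_zero, mul_zero]

/-- The matrix `1 + W ε e_a^i`, which differs from the identity matrix in column `i` only. -/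
def oneAddCol (W : SMat A p q p' q') (a : Fin p' ⊕ Fin q') (i : Fin p ⊕ Fin q) (ε : A.carrier)
    (hε : ε ∈ A.gr (par a + par i)) : SMat A p q p q where
  val := 1 + W.val * Matrix.single a i ε
  mem k l := by
    refine Submodule.add_mem _ ((one A p q).mem k l) ?_
    by_cases h : l = i
    · subst h
      rw [Matrix.mul_single_apply_same]
      refine A.mul_mem_gr (W.mem k a) hε ?_
      have h : ∀ a b c : ZMod 2, a + b + (b + c) = a + c := by decide
      exact h _ _ _
    · rw [Matrix.mul_single_apply_of_ne _ _ _ _ _ h]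
      exact Submodule.zero_mem _

theorem oneAddCol_mul_neg (W : SMat A p q p' q') (a : Fin p' ⊕ Fin q') (i : Fin p ⊕ Fin q)
    (ε : A.carrier) (hε : ε ∈ A.gr (par a + par i)) (hε' : -ε ∈ A.gr (par a + par i))
    (h0 : ε * ε = 0) : (oneAddCol W a i ε hε).mul (oneAddCol W a i (-ε) hε') = one A p q := by
  refine SMat.ext ?_
  have e : W.val * Matrix.single a i ε * (W.val * Matrix.single a i ε) = 0 := by
    rw [Matrix.mul_assoc, ← Matrix.mul_assoc (Matrix.single a i ε),
      Matrix.single_mul_mul_single, mul_mul_self_eq_zero hε (W.mem i a) h0, Matrix.single_zero,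
      Matrix.mul_zero]
  have e' : Matrix.single a i (-ε) = -Matrix.single a i ε :=
    map_neg (Matrix.singleAddMonoidHom a i) ε
  simp [mul, oneAddCol, one, Matrix.mul_add, Matrix.add_mul, e', e]

theorem isInv_oneAddCol (W : SMat A p q p' q') (a : Fin p' ⊕ Fin q') (i : Fin p ⊕ Fin q)
    (ε : A.carrier) (hε : ε ∈ A.gr (par a + par i)) (h0 : ε * ε = 0) :
    (oneAddCol W a i ε hε).IsInv := by
  refine ⟨oneAddCol W a i (-ε) (neg_mem hε), oneAddCol_mul_neg W a i ε hε _ h0, ?_⟩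
  have := oneAddCol_mul_neg W a i (-ε) (neg_mem hε) (by rwa [neg_neg]) (by simpa using h0)
  simpa using this

theorem inv_oneAddCol (W : SMat A p q p' q') (a : Fin p' ⊕ Fin q') (i : Fin p ⊕ Fin q)
    (ε : A.carrier) (hε : ε ∈ A.gr (par a + par i)) (h0 : ε * ε = 0) :
    (oneAddCol W a i ε hε).inv = oneAddCol W a i (-ε) (neg_mem hε) :=
  (eq_inv_of_mul_eq_one (isInv_oneAddCol W a i ε hε h0)
    (oneAddCol_mul_neg W a i ε hε _ h0)).symm

theorem oneAddCol_apply (W : SMat A p q p' q') (a : Fin p' ⊕ Fin q') (i : Fin p ⊕ Fin q)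
    (ε : A.carrier) (hε : ε ∈ A.gr (par a + par i)) (k l : Fin p ⊕ Fin q) :
    (oneAddCol W a i ε hε).val k l =
      (1 : Matrix (Fin p ⊕ Fin q) (Fin p ⊕ Fin q) A.carrier) k l +
        if l = i then W.val k a * ε else 0 := by
  change (1 + W.val * Matrix.single a i ε :
    Matrix (Fin p ⊕ Fin q) (Fin p ⊕ Fin q) A.carrier) k l = _
  rw [Matrix.add_apply]
  by_cases h : l = i
  · subst h
    rw [Matrix.mul_single_apply_same, if_pos rfl]
  · rw [Matrix.mul_single_apply_of_ne _ _ _ _ _ h, if_neg h]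

/-- Only column i changes. If i is even, the upper right block vanishes and the Berezinian is the
determinant of the even-even block. If i is odd, the lower left block vanishes and the Berezinian is
(1 + w)⁻¹ = 1 - w with w² = 0. Hence the sign, as in the supertrace. -/
theorem ber_oneAddCol (W : SMat A p q p' q') (a : Fin p' ⊕ Fin q') (i : Fin p ⊕ Fin q)
    (ε : A.carrier) (hε : ε ∈ A.gr (par a + par i)) (h0 : ε * ε = 0) :
    ((oneAddCol W a i ε hε).ber : A.carrier) =
      1 + (-1) ^ (par i).val * (W.val i a * ε) := by
  have hsq : W.val i a * ε * (W.val i a * ε) = 0 := by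
    rw [mul_assoc, ← mul_assoc ε, mul_mul_self_eq_zero hε (W.mem i a) h0, mul_zero]
  have hmem : ∀ k, W.val k a * ε ∈ A.gr (par k + par i) := fun k =>
    A.mul_mem_gr (W.mem k a) hε (by
      have h : ∀ a b c : ZMod 2, a + b + (b + c) = a + c := by decide
      exact h _ _ _)
  rcases i with i | i
  · have h11 : (oneAddCol W a (Sum.inl i) ε hε).b11 = 1 := evenMat_injective (by
      rw [evenMat_b11, evenMat_one]
      ext k l
      simp [Matrix.toBlocks₂₂, oneAddCol_apply, Matrix.one_apply])
    have h01 : (oneAddCol W a (Sum.inl i) ε hε).val.toBlocks₁₂ = 0 := by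
      ext k l
      simp [Matrix.toBlocks₁₂, oneAddCol_apply]
    have hs : (oneAddCol W a (Sum.inl i) ε hε).schur = 1 + Matrix.of fun k l =>
        if l = i then (⟨W.val (Sum.inl k) a * ε, hmem (Sum.inl k)⟩ : A.Even) else 0 :=
      evenMat_injective (by
        rw [evenMat_schur, h01, Matrix.zero_mul, Matrix.zero_mul, sub_zero, evenMat_b00,
          evenMat_add, evenMat_one]
        ext k l
        by_cases h : l = i
        · subst h
          simp only [Matrix.toBlocks₁₁, oneAddCol_apply, evenMat, Matrix.one_apply,
            Matrix.of_apply, Matrix.add_apply, Matrix.map_apply, if_true, Sum.inl.injEq]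
          rfl
        · simp [Matrix.toBlocks₁₁, oneAddCol_apply, evenMat, Matrix.one_apply, h])
    rw [ber, h11, hs, det_one_add_col, Matrix.det_one, Ring.inverse_one, mul_one]
    change 1 + W.val (Sum.inl i) a * ε = _
    simp [par]
  · have h00 : (oneAddCol W a (Sum.inr i) ε hε).b00 = 1 := evenMat_injective (by
      rw [evenMat_b00, evenMat_one]
      ext k l
      simp [Matrix.toBlocks₁₁, oneAddCol_apply, Matrix.one_apply])
    have h10 : (oneAddCol W a (Sum.inr i) ε hε).val.toBlocks₂₁ = 0 := by
      ext k l
      simp [Matrix.toBlocks₂₁, oneAddCol_apply]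
    have hs : (oneAddCol W a (Sum.inr i) ε hε).schur = 1 := evenMat_injective (by
        rw [evenMat_schur, h10, Matrix.mul_zero, sub_zero, h00])
    have h11 : (oneAddCol W a (Sum.inr i) ε hε).b11 = 1 + Matrix.of fun k l =>
        if l = i then (⟨W.val (Sum.inr k) a * ε, hmem (Sum.inr k)⟩ : A.Even) else 0 :=
      evenMat_injective (by
        rw [evenMat_b11, evenMat_add, evenMat_one]
        ext k l
        by_cases h : l = i
        · subst h
          simp only [Matrix.toBlocks₂₂, oneAddCol_apply, evenMat, Matrix.one_apply,
            Matrix.of_apply, Matrix.add_apply, Matrix.map_apply, if_true, Sum.inr.injEq]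
          rfl
        · simp [Matrix.toBlocks₂₂, oneAddCol_apply, evenMat, Matrix.one_apply, h])
    rw [ber, h11, hs, det_one_add_col, Matrix.det_one, one_mul]
    set w : A.Even := ⟨W.val (Sum.inr i) a * ε, hmem (Sum.inr i)⟩ with hw
    have hw2 : w * w = 0 := Subtype.ext hsq
    have e1 : (1 + w) * (1 - w) = 1 := by linear_combination -hw2
    have e2 : Ring.inverse (1 + w) = 1 - w := by
      have := Ring.inverse_unit (Units.mkOfMulEqOne _ _ e1)
      exact this
    rw [e2]
    change 1 - W.val (Sum.inr i) a * ε = _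
    simp [par, ZMod.val_one, sub_eq_add_neg]

/-- Factoring UP out on the left turns an increment of one entry into right multiplication, to which
multiplicativity of Ber and inversion of products apply. -/
theorem mul_addSingle (U : SMat A r s n m) (P : SMat A n m r s) (a : Fin n ⊕ Fin m)
    (i : Fin r ⊕ Fin s) (ε : A.carrier) (hε : ε ∈ A.gr (par a + par i))
    (h : (U.mul P).IsInv) :
    U.mul (P.addSingle a i ε hε) =
      (U.mul P).mul (oneAddCol ((U.mul P).inv.mul U) a i ε hε) := by
  have e := congrArg SMat.val (mul_inv_cancel h U)
  refine SMat.ext ?_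
  change U.val * (P.val + Matrix.single a i ε) =
    (U.mul P).val * (1 + ((U.mul P).inv.mul U).val * Matrix.single a i ε)
  rw [Matrix.mul_add, Matrix.mul_add, Matrix.mul_one, ← Matrix.mul_assoc]
  congr 2
  exact e.symm

/-- The increment of `Ber (U P)` in the direction of a matrix entry. -/
theorem ber_mul_addSingle (U : SMat A r s n m) (P : SMat A n m r s) (a : Fin n ⊕ Fin m)
    (i : Fin r ⊕ Fin s) (ε : A.carrier) (hε : ε ∈ A.gr (par a + par i)) (h0 : ε * ε = 0)
    (h : (U.mul P).IsInv) :
    ((U.mul (P.addSingle a i ε hε)).ber : A.carrier) = (U.mul P).ber *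
      (1 + (-1) ^ (par i).val * (((U.mul P).inv.mul U).val i a * ε)) := by
  rw [mul_addSingle U P a i ε hε h, ber_mul h.isUnit_det_b11
    (isInv_oneAddCol _ a i ε hε h0).isUnit_det_b11, ← ber_oneAddCol _ a i ε hε h0]
  rfl

/-- The increment of `(U P)⁻¹ U` in the direction of a matrix entry. -/
theorem inv_mul_addSingle (U : SMat A r s n m) (P : SMat A n m r s) (a b : Fin n ⊕ Fin m)
    (i j : Fin r ⊕ Fin s) (ε : A.carrier) (hε : ε ∈ A.gr (par a + par i)) (h0 : ε * ε = 0)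
    (h : (U.mul P).IsInv) :
    ((U.mul (P.addSingle a i ε hε)).inv.mul U).val j b = ((U.mul P).inv.mul U).val j b -
      ((U.mul P).inv.mul U).val j a * ε * ((U.mul P).inv.mul U).val i b := by
  rw [mul_addSingle U P a i ε hε h, inv_mul_rev h (isInv_oneAddCol _ a i ε hε h0),
    inv_oneAddCol _ a i ε hε h0, mul_assoc']
  set W := (U.mul P).inv.mul U
  change ((1 + W.val * Matrix.single a i (-ε) :
    Matrix (Fin r ⊕ Fin s) (Fin r ⊕ Fin s) A.carrier) *
    W.val) j b = _
  rw [Matrix.add_mul, Matrix.one_mul, Matrix.add_apply, Matrix.mul_apply,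
    Finset.sum_eq_single i]
  · rw [Matrix.mul_single_apply_same, mul_neg, neg_mul, sub_eq_add_neg]
  · intro k _ hk
    rw [Matrix.mul_single_apply_of_ne _ _ _ _ _ hk, zero_mul]
  · simp

end SMat

/-! ### The Plücker transform as a multivector: derivatives, base change and change of basis. -/

section Pluecker

open SuperAlg SMat

variable {𝕜 : Type u} [Field 𝕜] {A B C : SuperAlg.{u} 𝕜} {n m r s : ℕ}

theorem UnitContent.rename {σ τ R : Type*} [CommRing R] {f : MvPolynomial σ R} (e : σ → τ)
    (he : Function.Injective e) (hf : UnitContent f) : UnitContent (MvPolynomial.rename e f) := by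
  refine top_le_iff.mp (le_trans (top_le_iff.mpr hf) (Ideal.span_mono ?_))
  rintro _ ⟨d, rfl⟩
  exact ⟨d.mapDomain e, MvPolynomial.coeff_rename_mapDomain e he f d⟩

/-- The product of the determinants of the diagonal blocks of `U P`, modulo products of odd
variables: its domain of invertibility is the set of all `P` for which `U P` is invertible. -/
noncomputable def plDenFull (U : SMat A r s n m) : MvPolynomial (EvenCoord n m r s) A.Even :=
  plDen U * MvPolynomial.rename Sum.swap (plDen U.pi)

theorem unitContent_plDenFull (U : Frame A n m r s) : UnitContent (plDenFull U.mat) :=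
  (unitContent_plDen U).mul ((unitContent_plDen U.pi).rename _ Sum.swap_leftInverse.injective)

/-- The odd-odd block of (UP)^Π is the even-even block of UP, so the renamed factor tests the
latter. -/
theorem isUnit_plDenFull_iff (U : SMat A r s n m) (φ : A ⟶ B) (P : SMat B n m r s) :
    IsUnit ((plDenFull U).eval₂ (SuperAlg.even φ) P.coord) ↔ ((U.map φ).mul P).IsInv := by
  have e : P.coord ∘ Sum.swap = P.pi.coord := by
    funext x
    rcases x with x | x <;> rfl
  rw [plDenFull, MvPolynomial.eval₂_mul, MvPolynomial.eval₂_rename, e, IsUnit.mul_iff,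
    isUnit_plDen_iff, isUnit_plDen_iff, isInv_iff, and_comm]
  have : (U.pi.map φ).mul P.pi = ((U.map φ).mul P).pi := by
    rw [pi_mul]; rfl
  rw [this]
  rfl

/-- The matrix `(U P)⁻¹ U`. -/
noncomputable def plW (U : SMat A r s n m) (φ : A ⟶ B) (P : SMat B n m r s) : SMat B r s n m :=
  ((U.map φ).mul P).inv.mul (U.map φ)

theorem plW_map (U : SMat A r s n m) (φ : A ⟶ B) (ψ : B ⟶ C) (P : SMat B n m r s)
    (h : ((U.map φ).mul P).IsInv) : plW U (φ ≫ ψ) (P.map ψ) = (plW U φ P).map ψ := by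
  rw [plW, plW, SMat.map_mul, SMat.map_comp, ← SMat.map_inv ψ h, SMat.map_mul]

theorem plBer_map (U : SMat A r s n m) (φ : A ⟶ B) (ψ : B ⟶ C) (P : SMat B n m r s)
    (h : ((U.map φ).mul P).IsInv) :
    ((((U.map (φ ≫ ψ)).mul (P.map ψ)).ber : C.Even) : C.carrier) =
      app ψ ((U.map φ).mul P).ber := by
  rw [← SuperAlg.coe_even, ← SMat.ber_map ψ _ h.isUnit_det_b11, SMat.map_mul, SMat.map_comp]

/-- The Plücker transform on the domain where `U P` is invertible. -/
noncomputable def plReg (U : Frame A n m r s) : RatFun A n m r s where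
  den := plDenFull U.mat
  den_unitContent := unitContent_plDenFull U
  val φ P := ((U.mat.map φ).mul P).ber
  natural φ ψ P h := plBer_map _ φ ψ P ((isUnit_plDenFull_iff _ _ _).mp h)

/-- The first partial derivatives of the Plücker transform. -/
noncomputable def plDeriv (U : Frame A n m r s) (b : Fin n ⊕ Fin m) (j : Fin r ⊕ Fin s) :
    RatFun A n m r s where
  den := plDenFull U.mat
  den_unitContent := unitContent_plDenFull U
  val φ P := (-1) ^ (par b).val * (((U.mat.map φ).mul P).ber * (plW U.mat φ P).val j b)
  natural φ ψ P h := by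
    rw [isUnit_plDenFull_iff] at h
    rw [plBer_map _ φ ψ P h, plW_map _ φ ψ P h]
    simp [SMat.map]

/-- The second partial derivatives of the Plücker transform. -/
noncomputable def plDeriv₂ (U : Frame A n m r s) (a : Fin n ⊕ Fin m) (i : Fin r ⊕ Fin s)
    (b : Fin n ⊕ Fin m) (j : Fin r ⊕ Fin s) : RatFun A n m r s where
  den := plDenFull U.mat
  den_unitContent := unitContent_plDenFull U
  val φ P := (-1) ^ (par b).val * (((U.mat.map φ).mul P).ber *
    ((-1) ^ (par a).val * ((plW U.mat φ P).val i a * (plW U.mat φ P).val j b) -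
      (-1) ^ ((par j + par a).val * (par a + par i).val) *
        ((plW U.mat φ P).val j a * (plW U.mat φ P).val i b)))
  natural φ ψ P h := by
    rw [isUnit_plDenFull_iff] at h
    rw [plBer_map _ φ ψ P h, plW_map _ φ ψ P h]
    simp [SMat.map]

theorem neg_one_pow_eq_of_mod {R : Type*} [Ring R] {a b : ℕ} (h : a % 2 = b % 2) :
    (-1 : R) ^ a = (-1) ^ b := by
  rw [neg_one_pow_eq_pow_mod_two, h, ← neg_one_pow_eq_pow_mod_two]

/-- Since t² = t in ℤ/2, the exponent (x + y)(y + x) is just x + y. This combines the sign of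
`ber_oneAddCol` with the one from carrying ε past an entry of W. -/
theorem neg_one_pow_par_mul {R : Type*} [Ring R] (x y : ZMod 2) :
    (-1 : R) ^ y.val = (-1) ^ x.val * (-1) ^ ((x + y).val * (y + x).val) := by
  rw [← pow_add]
  refine neg_one_pow_eq_of_mod ?_
  revert x y
  decide

/-- The first order term of `ber_mul_addSingle`, with ε carried to the left as a left derivative
requires. -/
theorem plReg_isPartial (U : Frame A n m r s) (b : Fin n ⊕ Fin m) (j : Fin r ⊕ Fin s) :
    (plReg U).IsPartial b j (plDeriv U b j) := by
  intro B φ P ε hε h0 hd _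
  have h := (isUnit_plDenFull_iff _ _ _).mp hd
  have e := ber_mul_addSingle (U.mat.map φ) P b j ε hε h0 h
  change _ = _ + ε * ((-1) ^ (par b).val *
    (((U.mat.map φ).mul P).ber * (plW U.mat φ P).val j b))
  refine e.trans ?_
  change _ * (1 + _ * ((plW U.mat φ P).val j b * ε)) = _
  rw [B.comm ((plW U.mat φ P).mem j b) hε, neg_one_pow_par_mul (par j) (par b)]
  change _ = (((U.mat.map φ).mul P).ber : B.carrier) + _
  have hF := mul_comm_of_even ((U.mat.map φ).mul P).ber.2 hε
  generalize ((((U.mat.map φ).mul P).ber : B.Even) : B.carrier) = F at *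
  rcases neg_one_pow_eq_or B.carrier (par j).val with h1 | h1 <;>
    rcases neg_one_pow_eq_or B.carrier ((par j + par b).val * (par b + par j).val) with
      h2 | h2 <;>
    simp [h1, h2, mul_add, ← mul_assoc, hF]

/-- The product rule for Ber(UP)·W_{jb}, from the increments of the two factors. -/
theorem plDeriv_isPartial (U : Frame A n m r s) (a : Fin n ⊕ Fin m) (i : Fin r ⊕ Fin s)
    (b : Fin n ⊕ Fin m) (j : Fin r ⊕ Fin s) :
    (plDeriv U b j).IsPartial a i (plDeriv₂ U a i b j) := by
  intro B φ P ε hε h0 hd _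
  have h := (isUnit_plDenFull_iff _ _ _).mp hd
  have e1 := ber_mul_addSingle (U.mat.map φ) P a i ε hε h0 h
  have e2 := inv_mul_addSingle (U.mat.map φ) P a b i j ε hε h0 h
  change (-1) ^ (par b).val * (((U.mat.map φ).mul (P.addSingle a i ε hε)).ber *
      (((U.mat.map φ).mul (P.addSingle a i ε hε)).inv.mul (U.mat.map φ)).val j b) =
    (-1) ^ (par b).val * (((U.mat.map φ).mul P).ber * (plW U.mat φ P).val j b) +
    ε * ((-1) ^ (par b).val * (((U.mat.map φ).mul P).ber *
    ((-1) ^ (par a).val * ((plW U.mat φ P).val i a * (plW U.mat φ P).val j b) -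
      (-1) ^ ((par j + par a).val * (par a + par i).val) *
        ((plW U.mat φ P).val j a * (plW U.mat φ P).val i b))))
  rw [e1, e2]
  change (-1) ^ (par b).val * (((U.mat.map φ).mul P).ber *
      (1 + (-1) ^ (par i).val * ((plW U.mat φ P).val i a * ε)) *
      ((plW U.mat φ P).val j b - (plW U.mat φ P).val j a * ε * (plW U.mat φ P).val i b)) = _
  have hF := mul_comm_of_even ((U.mat.map φ).mul P).ber.2 hε
  have hz : ε * (plW U.mat φ P).val j a * ε = 0 :=
    mul_mul_self_eq_zero hε ((plW U.mat φ P).mem j a) h0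
  have c1 := B.comm ((plW U.mat φ P).mem i a) hε
  have c2 := B.comm ((plW U.mat φ P).mem j a) hε
  rw [neg_one_pow_par_mul (par i) (par a)]
  generalize ((((U.mat.map φ).mul P).ber : B.Even) : B.carrier) = F at *
  generalize (plW U.mat φ P).val i a = w1 at *
  generalize (plW U.mat φ P).val j a = w2 at *
  generalize (plW U.mat φ P).val j b = w3 at *
  generalize (plW U.mat φ P).val i b = w4 at *
  -- The product of the two increments contains ε twice.
  have hz' : w1 * ε * (w2 * ε * w4) = 0 := by
    rw [mul_assoc w1, ← mul_assoc ε, ← mul_assoc ε, hz, zero_mul, mul_zero]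
  have key : ∀ s1 s2 : B.carrier, (s1 = 1 ∨ s1 = -1) →
      F * (1 + s1 * (w1 * ε)) * (w3 - w2 * ε * w4) =
      F * w3 + s1 * (F * (w1 * ε) * w3) - F * (w2 * ε) * w4 := by
    intro s1 s2 h
    have h4 : F * (w1 * ε) * (w2 * ε * w4) = 0 := by rw [mul_assoc, hz', mul_zero]
    rcases h with rfl | rfl
    · simp only [one_mul, mul_add, add_mul, mul_sub, mul_one, mul_assoc]
      simp only [mul_assoc] at h4
      rw [h4]; abel
    · simp only [neg_mul, one_mul, mul_add, add_mul, mul_sub, mul_one, mul_neg, mul_assoc]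
      simp only [mul_assoc] at h4
      rw [h4]; abel
  rw [key _ 1 (neg_one_pow_eq_or B.carrier (par i).val), c1, c2]
  -- Signs are central, but powers of -1 are awkward in a noncommutative ring; each is replaced by 1
  -- or -1 and the terms are compared.
  rcases neg_one_pow_eq_or B.carrier (par b).val with h3 | h3 <;>
  rcases neg_one_pow_eq_or B.carrier (par i).val with h1 | h1 <;>
    rcases neg_one_pow_eq_or B.carrier ((par i + par a).val * (par a + par i).val) with
      h2 | h2 <;>
    rcases neg_one_pow_eq_or B.carrier ((par j + par a).val * (par a + par i).val) with
      h5 | h5 <;>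
    simp only [h1, h2, h3, h5, mul_add, mul_sub, ← mul_assoc, hF, one_mul, mul_one, neg_mul,
      mul_neg, neg_neg] <;> abel

/-- Let N = ĩj̃ + ã(ĩ + j̃). Then (j̃ + ã)(ã + ĩ) ≡ ã + N mod 2, so the second derivative is
(-1)^(ã+b̃) Ber(UP)(W_{ia}W_{jb} - (-1)^N W_{ja}W_{ib}). Exchanging i and j multiplies this by
-(-1)^N, as N is symmetric in i and j. -/
theorem plDeriv₂_fundamental (U : Frame A n m r s) (a b : Fin n ⊕ Fin m)
    (i j : Fin r ⊕ Fin s) (φ : A ⟶ B) (P : SMat B n m r s) :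
    (plDeriv₂ U a i b j).val φ P + (-1) ^ ((par i).val * (par j).val +
        (par a).val * ((par i).val + (par j).val)) * (plDeriv₂ U a j b i).val φ P = 0 := by
  change (-1) ^ (par b).val * (((U.mat.map φ).mul P).ber *
    ((-1) ^ (par a).val * ((plW U.mat φ P).val i a * (plW U.mat φ P).val j b) -
      (-1) ^ ((par j + par a).val * (par a + par i).val) *
        ((plW U.mat φ P).val j a * (plW U.mat φ P).val i b))) + _ * (
    (-1) ^ (par b).val * (((U.mat.map φ).mul P).ber *
    ((-1) ^ (par a).val * ((plW U.mat φ P).val j a * (plW U.mat φ P).val i b) -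
      (-1) ^ ((par i + par a).val * (par a + par j).val) *
        ((plW U.mat φ P).val i a * (plW U.mat φ P).val j b)))) = 0
  have e1 : ∀ x y z : ZMod 2, ((y + z).val * (z + x).val) % 2 =
      (z.val + (x.val * y.val + z.val * (x.val + y.val))) % 2 := by decide
  have s1 := neg_one_pow_eq_of_mod (R := B.carrier) (e1 (par i) (par j) (par a))
  have s2 := neg_one_pow_eq_of_mod (R := B.carrier) (e1 (par j) (par i) (par a))
  rw [mul_comm (par j).val, add_comm (par j).val] at s2
  generalize (par i).val * (par j).val + (par a).val * ((par i).val + (par j).val) = N at *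
  rw [s1, s2, pow_add]
  rcases neg_one_pow_eq_or B.carrier (par a).val with h1 | h1 <;>
  rcases neg_one_pow_eq_or B.carrier (par b).val with h2 | h2 <;>
  rcases neg_one_pow_eq_or B.carrier N with h3 | h3 <;>
  simp only [h1, h2, h3, one_mul, mul_one, neg_mul, mul_neg, neg_neg, mul_sub, sub_neg_eq_add,
    mul_add] <;> abel

theorem plReg_isMultivector (U : Frame A n m r s) : (plReg U).IsMultivector where
  even B φ P _ := ((U.mat.map φ).mul P).ber.2
  covariant B φ P g hg hd _ := by
    have h := (isUnit_plDenFull_iff _ _ _).mp hd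
    change ((((U.mat.map φ).mul (P.mul g)).ber : B.Even) : B.carrier) = _
    rw [← mul_assoc', ber_mul h.isUnit_det_b11 hg.isUnit_det_b11]
    rfl
  fundamental := ⟨plDeriv U, plDeriv₂ U, plReg_isPartial U, plDeriv_isPartial U,
    fun a b i j _ φ P _ _ => plDeriv₂_fundamental U a b i j φ P⟩

/-- Ber(UP) needs only the odd-odd block to be invertible, while the derivatives involve (UP)⁻¹.
Rational functions may be compared on a smaller domain, so the multivector conditions can be
verified where all of UP is invertible. -/
theorem pl_rel_plReg (U : Frame A n m r s) : pl U ≈ plReg U :=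
  ⟨plDenFull U.mat, unitContent_plDenFull U, fun _ φ P hP =>
    ⟨(isUnit_plDen_iff _ φ P).mpr ((isUnit_plDenFull_iff _ _ _).mp hP).isUnit_det_b11, hP, rfl⟩⟩

theorem mk_pl (U : Frame A n m r s) :
    (Quotient.mk _ (pl U) : RatClass A n m r s) = Quotient.mk _ (plReg U) :=
  Quotient.sound (pl_rel_plReg U)

theorem pl_isMultivector (U : Frame A n m r s) :
    RatClass.IsMultivector (Quotient.mk _ (pl U) : RatClass A n m r s) :=
  ⟨plReg U, (mk_pl U).symm, plReg_isMultivector U⟩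

theorem pl_map (φ : A ⟶ B) (U : Frame A n m r s) :
    RatClass.map φ (Quotient.mk _ (pl U)) = Quotient.mk _ (pl (U.map φ)) := by
  refine Quotient.sound ⟨plDenFull (U.map φ).mat, unitContent_plDenFull _, fun C ψ P hP => ?_⟩
  have h := ((isUnit_plDenFull_iff _ _ _).mp hP).isUnit_det_b11
  exact ⟨(RatFun.map_dom _ _ _ _).mpr ((isUnit_plDen_iff _ (φ ≫ ψ) P).mpr h),
    (isUnit_plDen_iff _ ψ P).mpr h, rfl⟩

/-- The change of the Plücker transform under a change of basis. -/
theorem pl_mul {U U' : Frame A n m r s} {g : SMat A r s r s} (hg : g.IsInv)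
    (e : U'.mat = g.mul U.mat) :
    (Quotient.mk _ (pl U') : RatClass A n m r s) = RatClass.smul g.ber (Quotient.mk _ (pl U)) := by
  refine Quotient.sound ⟨plDenFull U.mat, unitContent_plDenFull _, fun C φ P hP => ?_⟩
  have h := (isUnit_plDenFull_iff _ _ _).mp hP
  have e' : (U'.mat.map φ).mul P = (g.map φ).mul ((U.mat.map φ).mul P) := by
    rw [e, SMat.map_mul, mul_assoc']
  refine ⟨(isUnit_plDen_iff _ φ P).mpr ?_, (isUnit_plDen_iff _ φ P).mpr h.isUnit_det_b11, ?_⟩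
  · rw [e']
    exact ((hg.map φ).mul h).isUnit_det_b11
  · change ((((U'.mat.map φ).mul P).ber : C.Even) : C.carrier) =
      app φ g.ber * (((U.mat.map φ).mul P).ber : C.carrier)
    rw [e', ber_mul (hg.map φ).isUnit_det_b11 h.isUnit_det_b11, ber_map φ g hg.isUnit_det_b11]
    rfl

end Pluecker

/-! ### Construction of superalgebras -/

theorem ZMod.eq_zero_or_one (i : ZMod 2) : i = 0 ∨ i = 1 := by
  revert i
  decide

namespace SuperAlg

open scoped TensorProduct

variable {𝕜 : Type u} [Field 𝕜]

theorem exists_even_add_odd (A : SuperAlg 𝕜) (a : A.carrier) :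
    ∃ x ∈ A.gr 0, ∃ y ∈ A.gr 1, a = x + y := by
  refine DirectSum.Decomposition.inductionOn A.gr ?_ ?_ ?_ a
  · exact ⟨0, zero_mem _, 0, zero_mem _, (add_zero 0).symm⟩
  · intro i m
    rcases ZMod.eq_zero_or_one i with rfl | rfl
    · exact ⟨m, m.2, 0, zero_mem _, (add_zero _).symm⟩
    · exact ⟨0, zero_mem _, m, m.2, (zero_add _).symm⟩
  · rintro _ _ ⟨x, hx, y, hy, rfl⟩ ⟨x', hx', y', hy', rfl⟩
    exact ⟨x + x', add_mem hx hx', y + y', add_mem hy hy', by abel⟩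

theorem even_mul_comm (A : SuperAlg 𝕜) {x : A.carrier} (hx : x ∈ A.gr 0) (b : A.carrier) :
    x * b = b * x := by
  obtain ⟨y, hy, z, hz, rfl⟩ := A.exists_even_add_odd b
  rw [mul_add, add_mul, mul_comm_of_even hx hy, mul_comm_of_even hx hz]

/-- The parity involution as a linear map. -/
noncomputable def involLin (A : SuperAlg 𝕜) : A.carrier →ₗ[𝕜] A.carrier :=
  GradedAlgebra.proj A.gr 0 - GradedAlgebra.proj A.gr 1

theorem involLin_add (A : SuperAlg 𝕜) {x y : A.carrier} (hx : x ∈ A.gr 0) (hy : y ∈ A.gr 1) :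
    A.involLin (x + y) = x - y := by
  have h : (0 : ZMod 2) ≠ 1 := by decide
  rw [involLin, LinearMap.sub_apply, map_add, map_add, GradedAlgebra.proj_apply,
    GradedAlgebra.proj_apply, GradedAlgebra.proj_apply, GradedAlgebra.proj_apply,
    DirectSum.decompose_of_mem_same _ hx, DirectSum.decompose_of_mem_same _ hy,
    DirectSum.decompose_of_mem_ne _ hx h, DirectSum.decompose_of_mem_ne _ hy h.symm]
  abel

/-- The parity involution of a superalgebra. -/
noncomputable def invol (A : SuperAlg 𝕜) : A.carrier →ₐ[𝕜] A.carrier :=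
  AlgHom.ofLinearMap A.involLin
    (by
      have := A.involLin_add (SetLike.GradedOne.one_mem : (1 : A.carrier) ∈ A.gr 0) (zero_mem _)
      simpa using this)
    (fun a b => by
      obtain ⟨x, hx, y, hy, rfl⟩ := A.exists_even_add_odd a
      obtain ⟨z, hz, w, hw, rfl⟩ := A.exists_even_add_odd b
      have e : (x + y) * (z + w) = (x * z + y * w) + (x * w + y * z) := by noncomm_ring
      rw [e, A.involLin_add hx hy, A.involLin_add hz hw, A.involLin_add]
      · noncomm_ring
      · exact add_mem (A.mul_mem_gr hx hz (by decide)) (A.mul_mem_gr hy hw (by decide))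
      · exact add_mem (A.mul_mem_gr hx hw (by decide)) (A.mul_mem_gr hy hz (by decide)))

theorem invol_add (A : SuperAlg 𝕜) {x y : A.carrier} (hx : x ∈ A.gr 0) (hy : y ∈ A.gr 1) :
    A.invol (x + y) = x - y := A.involLin_add hx hy

theorem invol_even (A : SuperAlg 𝕜) {x : A.carrier} (hx : x ∈ A.gr 0) : A.invol x = x := by
  simpa using A.invol_add hx (zero_mem _)

theorem invol_odd (A : SuperAlg 𝕜) {y : A.carrier} (hy : y ∈ A.gr 1) : A.invol y = -y := by
  simpa using A.invol_add (zero_mem _) hy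

theorem invol_invol (A : SuperAlg 𝕜) (a : A.carrier) : A.invol (A.invol a) = a := by
  obtain ⟨x, hx, y, hy, rfl⟩ := A.exists_even_add_odd a
  rw [A.invol_add hx hy, sub_eq_add_neg, A.invol_add hx (neg_mem hy), sub_neg_eq_add]

theorem add_invol_mem (A : SuperAlg 𝕜) (a : A.carrier) : a + A.invol a ∈ A.gr 0 := by
  obtain ⟨x, hx, y, hy, rfl⟩ := A.exists_even_add_odd a
  rw [A.invol_add hx hy, show x + y + (x - y) = x + x by abel]
  exact add_mem hx hx

theorem sub_invol_mem (A : SuperAlg 𝕜) (a : A.carrier) : a - A.invol a ∈ A.gr 1 := by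
  obtain ⟨x, hx, y, hy, rfl⟩ := A.exists_even_add_odd a
  rw [A.invol_add hx hy, show x + y - (x - y) = y + y by abel]
  exact add_mem hy hy

/-! ### Superalgebra structures from a parity involution. -/

section OfInvolution

variable {C : Type u} [Ring C] [Algebra 𝕜 C]

/-- The eigenspaces of an involution. -/
def eigenGr (σ : C →ₐ[𝕜] C) (i : ZMod 2) : Submodule 𝕜 C where
  carrier := {x | σ x = (-1 : 𝕜) ^ i.val • x}
  zero_mem' := by simp
  add_mem' {x y} hx hy := by
    change σ (x + y) = _
    rw [map_add, smul_add]
    exact congrArg₂ _ hx hy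
  smul_mem' c x hx := by
    change σ (c • x) = _
    rw [map_smul, smul_comm]
    exact congrArg _ hx

theorem mem_eigenGr_zero {σ : C →ₐ[𝕜] C} {x : C} : x ∈ eigenGr σ 0 ↔ σ x = x := by
  change σ x = _ ↔ _
  simp

theorem mem_eigenGr_one {σ : C →ₐ[𝕜] C} {x : C} : x ∈ eigenGr σ 1 ↔ σ x = -x := by
  change σ x = _ ↔ _
  simp [ZMod.val_one]

theorem two_smul_cancel (h2 : (2 : 𝕜) ≠ 0) {x y : C} (h : x + x = y + y) : x = y := by
  rw [← two_smul 𝕜, ← two_smul 𝕜] at h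
  exact smul_right_injective C h2 h

theorem isInternal_eigenGr (h2 : (2 : 𝕜) ≠ 0) (σ : C →ₐ[𝕜] C) (hσ : ∀ x, σ (σ x) = x) :
    DirectSum.IsInternal (eigenGr σ) := by
  rw [DirectSum.isInternal_submodule_iff_isCompl (eigenGr σ) (i := 0) (j := 1) (by decide)
    (Set.ext fun i => by simpa using ZMod.eq_zero_or_one i)]
  refine ⟨Submodule.disjoint_def.mpr fun x h0 h1 => ?_, codisjoint_iff_le_sup.mpr fun x _ => ?_⟩
  · rw [mem_eigenGr_zero] at h0
    rw [mem_eigenGr_one, h0] at h1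
    refine two_smul_cancel h2 ?_
    rw [add_zero]
    nth_rewrite 1 [h1]
    simp
  · have e : x = (2 : 𝕜)⁻¹ • (x + σ x) + (2 : 𝕜)⁻¹ • (x - σ x) := by
      rw [← smul_add, show x + σ x + (x - σ x) = x + x by abel, ← two_smul 𝕜, smul_smul,
        inv_mul_cancel₀ h2, one_smul]
    rw [e]
    refine Submodule.add_mem_sup (Submodule.smul_mem _ _ (mem_eigenGr_zero.mpr ?_))
      (Submodule.smul_mem _ _ (mem_eigenGr_one.mpr ?_))
    · rw [map_add, hσ, add_comm]
    · rw [map_sub, hσ, neg_sub]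

/-- The superalgebra with a given parity involution. -/
noncomputable def ofInvolution (h2 : (2 : 𝕜) ≠ 0) (σ : C →ₐ[𝕜] C) (hσ : ∀ x, σ (σ x) = x)
    (h0 : ∀ a b, (a + σ a) * b = b * (a + σ a))
    (h1 : ∀ a b, (a - σ a) * (b - σ b) = -((b - σ b) * (a - σ a))) : SuperAlg 𝕜 :=
  -- The hypotheses speak of a ± σ(a), which is additive in arbitrary a and so can be checked on
  -- generators such as pure tensors. On eigenvectors these are 2a, and the factors 2 are cancelled.
  have c0 : ∀ {a b : C}, a ∈ eigenGr σ 0 → a * b = b * a := fun {a b} ha => by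
    have := h0 a b
    rw [mem_eigenGr_zero.mp ha] at this
    exact two_smul_cancel h2 (by simpa [add_mul, mul_add] using this)
  have c1 : ∀ {a b : C}, a ∈ eigenGr σ 1 → b ∈ eigenGr σ 1 → a * b = -(b * a) :=
    fun {a b} ha hb => by
      have := h1 a b
      rw [mem_eigenGr_one.mp ha, mem_eigenGr_one.mp hb] at this
      refine two_smul_cancel h2 (two_smul_cancel h2 ?_)
      simp only [sub_neg_eq_add, add_mul, mul_add, neg_add] at this
      rw [← add_assoc] at this
      convert this using 1
      abel
  { carrier := C
    gr := eigenGr σ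
    graded :=
      { one_mem := mem_eigenGr_zero.mpr (map_one σ)
        mul_mem := fun i j a b ha hb => by
          change σ (a * b) = _
          have ha : σ a = _ := ha
          have hb : σ b = _ := hb
          rw [map_mul, ha, hb, smul_mul_smul_comm]
          congr 1
          rw [← pow_add]
          have h : ∀ i j : ZMod 2, (i.val + j.val) % 2 = (i + j).val % 2 := by decide
          exact neg_one_pow_eq_of_mod (h i j)
        toDecomposition := (isInternal_eigenGr h2 σ hσ).chooseDecomposition }
    comm := fun {i j a b} ha hb => by
      rcases ZMod.eq_zero_or_one i with rfl | rfl <;>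
        rcases ZMod.eq_zero_or_one j with rfl | rfl
      · simpa using c0 ha
      · simpa using c0 ha
      · simpa using (c0 hb).symm
      · simpa [ZMod.val_one] using c1 ha hb
    odd_sq := fun {a} ha => by
      refine two_smul_cancel h2 ?_
      have := c1 ha ha
      rw [add_zero]
      nth_rewrite 1 [this]
      simp }

theorem map_mem_eigenGr {A : SuperAlg 𝕜} (σ : C →ₐ[𝕜] C) (f : A.carrier →ₐ[𝕜] C)
    (hf : ∀ a, σ (f a) = f (A.invol a)) {i : ZMod 2} {a : A.carrier} (ha : a ∈ A.gr i) :
    f a ∈ eigenGr σ i := by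
  rcases ZMod.eq_zero_or_one i with rfl | rfl
  · rw [mem_eigenGr_zero, hf, A.invol_even ha]
  · rw [mem_eigenGr_one, hf, A.invol_odd ha, map_neg]

/-- A morphism to the superalgebra with a given parity involution. -/
noncomputable def toOfInvolution {A : SuperAlg 𝕜} (h2 : (2 : 𝕜) ≠ 0) (σ : C →ₐ[𝕜] C) (hσ h0 h1)
    (f : A.carrier →ₐ[𝕜] C) (hf : ∀ a, σ (f a) = f (A.invol a)) :
    A ⟶ ofInvolution h2 σ hσ h0 h1 :=
  Hom.mk f (map_mem_eigenGr σ f hf)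

end OfInvolution

/-! ### Extension by an odd variable -/

/-- The algebra `A[θ]` with `θ` odd; the pair `(a, b)` stands for `a + b θ`. -/
def AdjoinOdd (A : SuperAlg 𝕜) : Type u := A.carrier × A.carrier

namespace AdjoinOdd

variable {A : SuperAlg 𝕜}

instance : AddCommGroup (AdjoinOdd A) := inferInstanceAs (AddCommGroup (A.carrier × A.carrier))

instance : Module 𝕜 (AdjoinOdd A) := inferInstanceAs (Module 𝕜 (A.carrier × A.carrier))

/-- The rules are θ² = 0 and θc = σ(c)θ, with σ the parity involution, so (a + bθ)(c + dθ) = ac +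
(ad + bσ(c))θ. -/
noncomputable instance : Mul (AdjoinOdd A) :=
  ⟨fun x y => (x.1 * y.1, x.1 * y.2 + x.2 * A.invol y.1)⟩

instance : One (AdjoinOdd A) := ⟨((1 : A.carrier), (0 : A.carrier))⟩

theorem ext {x y : AdjoinOdd A} (h1 : x.1 = y.1) (h2 : x.2 = y.2) : x = y := Prod.ext h1 h2

@[simp] theorem fst_mul (x y : AdjoinOdd A) : (x * y).1 = x.1 * y.1 := rfl

@[simp] theorem snd_mul (x y : AdjoinOdd A) :
    (x * y).2 = x.1 * y.2 + x.2 * A.invol y.1 := rfl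

@[simp] theorem fst_one : (1 : AdjoinOdd A).1 = 1 := rfl

@[simp] theorem snd_one : (1 : AdjoinOdd A).2 = 0 := rfl

@[simp] theorem fst_zero : (0 : AdjoinOdd A).1 = 0 := rfl

@[simp] theorem snd_zero : (0 : AdjoinOdd A).2 = 0 := rfl

@[simp] theorem fst_add (x y : AdjoinOdd A) : (x + y).1 = x.1 + y.1 := rfl

@[simp] theorem snd_add (x y : AdjoinOdd A) : (x + y).2 = x.2 + y.2 := rfl

@[simp] theorem fst_neg (x : AdjoinOdd A) : (-x).1 = -x.1 := rfl

@[simp] theorem snd_neg (x : AdjoinOdd A) : (-x).2 = -x.2 := rfl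

@[simp] theorem fst_sub (x y : AdjoinOdd A) : (x - y).1 = x.1 - y.1 := rfl

@[simp] theorem snd_sub (x y : AdjoinOdd A) : (x - y).2 = x.2 - y.2 := rfl

@[simp] theorem fst_smul (c : 𝕜) (x : AdjoinOdd A) : (c • x).1 = c • x.1 := rfl

@[simp] theorem snd_smul (c : 𝕜) (x : AdjoinOdd A) : (c • x).2 = c • x.2 := rfl

noncomputable instance : Ring (AdjoinOdd A) :=
  { (inferInstance : AddCommGroup (AdjoinOdd A)) with
    mul := (· * ·)
    one := 1
    mul_assoc := fun x y z => ext (by simp [mul_assoc])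
      (by simp [mul_assoc, mul_add, add_mul, add_assoc])
    one_mul := fun x => ext (by simp) (by simp)
    mul_one := fun x => ext (by simp) (by simp)
    left_distrib := fun x y z => ext (by simp [mul_add]) (by simp [mul_add]; abel)
    right_distrib := fun x y z => ext (by simp [add_mul]) (by simp [add_mul]; abel)
    zero_mul := fun x => ext (by simp) (by simp)
    mul_zero := fun x => ext (by simp) (by simp) }

noncomputable instance : Algebra 𝕜 (AdjoinOdd A) :=
  Algebra.ofModule (fun c x y => ext (by simp) (by simp))
    (fun c x y => ext (by simp) (by simp))

/-- The element `a + b θ`. -/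
def mk (a b : A.carrier) : AdjoinOdd A := (a, b)

@[simp] theorem fst_mk (a b : A.carrier) : (mk a b).1 = a := rfl

@[simp] theorem snd_mk (a b : A.carrier) : (mk a b).2 = b := rfl

/-- The parity involution as a linear map. -/
noncomputable def involLin : AdjoinOdd A →ₗ[𝕜] AdjoinOdd A where
  -- The minus sign is that of θ ↦ -θ.
  toFun x := mk (A.invol x.1) (-A.invol x.2)
  map_add' x y := ext (by simp) (by simp; abel)
  map_smul' c x := ext (by simp) (by simp)

@[simp] theorem fst_involLin (x : AdjoinOdd A) : (involLin x).1 = A.invol x.1 := rfl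

@[simp] theorem snd_involLin (x : AdjoinOdd A) : (involLin x).2 = -A.invol x.2 := rfl

/-- The parity involution. -/
noncomputable def invol : AdjoinOdd A →ₐ[𝕜] AdjoinOdd A :=
  AlgHom.ofLinearMap involLin (ext (by simp) (by simp))
    (fun x y => ext (by simp) (by simp [A.invol_invol]; abel))

@[simp] theorem fst_invol (x : AdjoinOdd A) : (invol x).1 = A.invol x.1 := rfl

@[simp] theorem snd_invol (x : AdjoinOdd A) : (invol x).2 = -A.invol x.2 := rfl

/-- The inclusion of `A`. -/
noncomputable def incl : A.carrier →ₐ[𝕜] AdjoinOdd A :=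
  AlgHom.ofLinearMap
    { toFun := fun a => mk a 0
      map_add' := fun a b => ext rfl (by simp)
      map_smul' := fun c a => ext rfl (by simp) } rfl
    (fun a b => ext rfl (by simp))

@[simp] theorem fst_incl (a : A.carrier) : (incl a).1 = a := rfl

@[simp] theorem snd_incl (a : A.carrier) : (incl a).2 = 0 := rfl

theorem invol_invol (x : AdjoinOdd A) : invol (invol x) = x :=
  ext (by simp [A.invol_invol]) (by simp [A.invol_invol])

/-- The odd variable. -/
def theta (A : SuperAlg 𝕜) : AdjoinOdd A := mk 0 1

theorem invol_theta : invol (theta A) = -theta A := ext (by simp [theta]) (by simp [theta])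

theorem theta_mul_theta : theta A * theta A = 0 := ext (by simp [theta]) (by simp [theta])

theorem snd_incl_mul_theta (a : A.carrier) : (incl a * theta A).2 = a := by simp [theta]

theorem odd_mul_invol {y : A.carrier} (hy : y ∈ A.gr 1) (c : A.carrier) :
    y * A.invol c = c * y := by
  obtain ⟨z, hz, w, hw, rfl⟩ := A.exists_even_add_odd c
  rw [A.invol_add hz hw, mul_sub, add_mul, mul_comm_of_odd hy hw, A.even_mul_comm hz,
    sub_neg_eq_add]

theorem comm_even (x y : AdjoinOdd A) : (x + invol x) * y = y * (x + invol x) := by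
  have h0 := A.add_invol_mem x.1
  have h1 := A.sub_invol_mem x.2
  refine ext ?_ ?_
  · exact A.even_mul_comm h0 _
  · change (x.1 + A.invol x.1) * y.2 + (x.2 + -A.invol x.2) * A.invol y.1 =
      y.1 * (x.2 + -A.invol x.2) + y.2 * A.invol (x.1 + A.invol x.1)
    rw [← sub_eq_add_neg, odd_mul_invol h1, A.invol_even h0, A.even_mul_comm h0, add_comm]

theorem comm_odd (x y : AdjoinOdd A) :
    (x - invol x) * (y - invol y) = -((y - invol y) * (x - invol x)) := by
  have h0 := A.sub_invol_mem x.1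
  have h1 := A.sub_invol_mem y.1
  have g0 := A.add_invol_mem x.2
  have g1 := A.add_invol_mem y.2
  refine ext ?_ ?_
  · exact mul_comm_of_odd h0 h1
  · change (x.1 - A.invol x.1) * (y.2 - -A.invol y.2) +
      (x.2 - -A.invol x.2) * A.invol (y.1 - A.invol y.1) =
      -((y.1 - A.invol y.1) * (x.2 - -A.invol x.2) +
        (y.2 - -A.invol y.2) * A.invol (x.1 - A.invol x.1))
    rw [A.invol_odd h0, A.invol_odd h1, sub_neg_eq_add, sub_neg_eq_add, A.even_mul_comm g0,
      A.even_mul_comm g1]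
    noncomm_ring

end AdjoinOdd

/-- The superalgebra `A[θ]` with `θ` odd. -/
noncomputable def adjoinOdd (h2 : (2 : 𝕜) ≠ 0) (A : SuperAlg 𝕜) : SuperAlg 𝕜 :=
  ofInvolution h2 (AdjoinOdd.invol (A := A)) AdjoinOdd.invol_invol AdjoinOdd.comm_even
    AdjoinOdd.comm_odd

/-- In A[θ] the coefficient of aθ at θ is a. Such a θ serves as an increment that can be cancelled
from first order identities. -/
theorem exists_odd_extension (h2 : (2 : 𝕜) ≠ 0) (A : SuperAlg 𝕜) :
    ∃ (B : SuperAlg 𝕜) (φ : A ⟶ B) (θ : B.carrier), θ ∈ B.gr 1 ∧ θ * θ = 0 ∧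
      ∀ a, app φ a * θ = 0 → a = 0 := by
  refine ⟨adjoinOdd h2 A, toOfInvolution h2 _ _ _ _ AdjoinOdd.incl fun a =>
    AdjoinOdd.ext (by simp) (by simp), AdjoinOdd.theta A,
    mem_eigenGr_one.mpr AdjoinOdd.invol_theta, AdjoinOdd.theta_mul_theta, fun a ha => ?_⟩
  have h : AdjoinOdd.incl a * AdjoinOdd.theta A = 0 := ha
  rw [← AdjoinOdd.snd_incl_mul_theta a, h]
  rfl

/-- Every superalgebra has an extension with a faithful element of square zero of given parity. -/
theorem exists_sq_zero_extension (h2 : (2 : 𝕜) ≠ 0) (A : SuperAlg 𝕜) (k : ZMod 2) :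
    ∃ (B : SuperAlg 𝕜) (φ : A ⟶ B) (ε : B.carrier), ε ∈ B.gr k ∧ ε * ε = 0 ∧
      ∀ a, app φ a * ε = 0 → a = 0 := by
  obtain ⟨B, φ, θ, hθ, h0, hB⟩ := exists_odd_extension h2 A
  rcases ZMod.eq_zero_or_one k with rfl | rfl
  -- An even increment is the product θη of two independent odd variables, cancelled one after the
  -- other.
  · obtain ⟨C, ψ, η, hη, h1, hC⟩ := exists_odd_extension h2 B
    refine ⟨C, φ ≫ ψ, app ψ θ * η, C.mul_mem_gr (app_mem ψ hθ) hη (by decide), ?_, ?_⟩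
    · rw [mul_assoc, ← mul_assoc η, mul_comm_of_odd hη (app_mem ψ hθ), neg_mul, mul_assoc, h1]
      simp
    · intro a ha
      refine hB a (hC _ ?_)
      rw [map_mul, mul_assoc]
      exact ha
  · exact ⟨B, φ, θ, hθ, h0, hB⟩

end SuperAlg

namespace SuperAlg

/-! ### Extension of the even scalars -/

open scoped TensorProduct

variable {𝕜 : Type u} [Field 𝕜]

/-- Even elements are central, so the even scalars can be extended by an ordinary tensor product
over the even part. -/
noncomputable instance (A : SuperAlg 𝕜) : Algebra A.Even A.carrier :=
  A.evenVal.toAlgebra' fun c x => A.even_mul_comm c.2 x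

theorem even_smul_def (A : SuperAlg 𝕜) (c : A.Even) (x : A.carrier) : c • x = c * x := rfl

instance (A : SuperAlg 𝕜) : IsScalarTower 𝕜 A.Even A.carrier :=
  ⟨fun c x y => by
    rw [even_smul_def, even_smul_def]
    exact smul_mul_assoc c (x : A.carrier) y⟩

/-- The parity involution is linear over the even part. -/
noncomputable def involEven (A : SuperAlg 𝕜) : A.carrier →ₐ[A.Even] A.carrier :=
  { A.invol with commutes' := fun c => A.invol_even c.2 }

section Extension

variable (A : SuperAlg 𝕜) (R : Type u) [CommRing R] [Algebra A.Even R]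

/-- The parity involution of `A ⊗ R`. -/
noncomputable def tensorInvol : A.carrier ⊗[A.Even] R →ₐ[𝕜] A.carrier ⊗[A.Even] R :=
  (Algebra.TensorProduct.map A.involEven (AlgHom.id A.Even R)).restrictScalars 𝕜

theorem tensorInvol_tmul (a : A.carrier) (x : R) :
    A.tensorInvol R (a ⊗ₜ x) = A.invol a ⊗ₜ x := rfl

theorem tensorInvol_tensorInvol (z : A.carrier ⊗[A.Even] R) :
    A.tensorInvol R (A.tensorInvol R z) = z := by
  induction z using TensorProduct.induction_on with
  | zero => simp
  | tmul a x => rw [tensorInvol_tmul, tensorInvol_tmul, A.invol_invol]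
  | add z w hz hw => rw [map_add, map_add, hz, hw]

theorem tensor_comm_even (z w : A.carrier ⊗[A.Even] R) :
    (z + A.tensorInvol R z) * w = w * (z + A.tensorInvol R z) := by
  induction z using TensorProduct.induction_on with
  | zero => simp
  | add z z' hz hz' =>
    rw [map_add, show z + z' + (A.tensorInvol R z + A.tensorInvol R z') =
      (z + A.tensorInvol R z) + (z' + A.tensorInvol R z') by abel, add_mul, mul_add, hz, hz']
  | tmul a x =>
    rw [tensorInvol_tmul, ← TensorProduct.add_tmul]
    induction w using TensorProduct.induction_on with
    | zero => simp
    | add w w' hw hw' => rw [add_mul, mul_add, hw, hw']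
    | tmul b y =>
      rw [Algebra.TensorProduct.tmul_mul_tmul, Algebra.TensorProduct.tmul_mul_tmul, mul_comm x,
        A.even_mul_comm (A.add_invol_mem a)]

theorem tensor_comm_odd (z w : A.carrier ⊗[A.Even] R) :
    (z - A.tensorInvol R z) * (w - A.tensorInvol R w) =
      -((w - A.tensorInvol R w) * (z - A.tensorInvol R z)) := by
  induction z using TensorProduct.induction_on with
  | zero => simp
  | add z z' hz hz' =>
    rw [map_add, show z + z' - (A.tensorInvol R z + A.tensorInvol R z') =
      (z - A.tensorInvol R z) + (z' - A.tensorInvol R z') by abel, add_mul, mul_add, hz, hz',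
      neg_add]
  | tmul a x =>
    rw [tensorInvol_tmul, ← TensorProduct.sub_tmul]
    induction w using TensorProduct.induction_on with
    | zero => simp
    | add w w' hw hw' =>
      rw [map_add, show w + w' - (A.tensorInvol R w + A.tensorInvol R w') =
        (w - A.tensorInvol R w) + (w' - A.tensorInvol R w') by abel, add_mul, mul_add, hw, hw',
        neg_add]
    | tmul b y =>
      rw [tensorInvol_tmul, ← TensorProduct.sub_tmul, Algebra.TensorProduct.tmul_mul_tmul,
        Algebra.TensorProduct.tmul_mul_tmul, mul_comm x,
        mul_comm_of_odd (A.sub_invol_mem a) (A.sub_invol_mem b), TensorProduct.neg_tmul]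

/-- The superalgebra `A ⊗ R` for a commutative algebra `R` over the even part of `A`. -/
noncomputable def extend (h2 : (2 : 𝕜) ≠ 0) : SuperAlg 𝕜 :=
  ofInvolution h2 (A.tensorInvol R) (A.tensorInvol_tensorInvol R) (A.tensor_comm_even R)
    (A.tensor_comm_odd R)

/-- The morphism `A ⟶ A ⊗ R`. -/
noncomputable def toExtend (h2 : (2 : 𝕜) ≠ 0) : A ⟶ A.extend R h2 :=
  toOfInvolution h2 _ _ _ _
    (Algebra.TensorProduct.includeLeft : A.carrier →ₐ[𝕜] A.carrier ⊗[A.Even] R) fun _ => rfl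

theorem one_tmul_mem (x : R) : (1 : A.carrier) ⊗ₜ[A.Even] x ∈ eigenGr (A.tensorInvol R) 0 := by
  rw [mem_eigenGr_zero, tensorInvol_tmul, map_one]

/-- The ring homomorphism from `R` to the even part of `A ⊗ R`. -/
noncomputable def extendScalar (h2 : (2 : 𝕜) ≠ 0) : R →+* (A.extend R h2).Even where
  toFun x := ⟨(1 : A.carrier) ⊗ₜ[A.Even] x, A.one_tmul_mem R x⟩
  map_one' := rfl
  map_mul' x y := Subtype.ext (by
    have := Algebra.TensorProduct.tmul_mul_tmul (R := A.Even) (1 : A.carrier) 1 x y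
    rw [mul_one] at this
    exact this.symm)
  map_zero' := Subtype.ext (TensorProduct.tmul_zero _ _)
  map_add' x y := Subtype.ext (TensorProduct.tmul_add _ _ _)

theorem extendScalar_algebraMap (h2 : (2 : 𝕜) ≠ 0) (c : A.Even) :
    A.extendScalar R h2 (algebraMap A.Even R c) = even (A.toExtend R h2) c :=
  Subtype.ext (by
    change (1 : A.carrier) ⊗ₜ[A.Even] algebraMap A.Even R c =
      (algebraMap A.Even A.carrier c) ⊗ₜ[A.Even] (1 : R)
    rw [Algebra.algebraMap_eq_smul_one, Algebra.algebraMap_eq_smul_one, TensorProduct.smul_tmul])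

theorem app_toExtend_injective (h2 : (2 : 𝕜) ≠ 0) [Module.FaithfullyFlat A.Even R] :
    Function.Injective (app (A.toExtend R h2)) := by
  have h := Module.FaithfullyFlat.tensorProduct_mk_injective (A := A.Even) (B := R) A.carrier
  intro a b hab
  exact h (congrArg (TensorProduct.comm A.Even A.carrier R) hab)

end Extension

/-- Flatness holds because R[x] is free over R and localization is flat. Unit content says that f is
non-zero modulo each maximal ideal M, so R[x]_f maps to the fraction field of (R/M)[x], and no fibre
is zero. -/
theorem _root_.UnitContent.faithfullyFlat_away {σ R : Type*} [CommRing R] {f : MvPolynomial σ R}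
    (hf : UnitContent f) : Module.FaithfullyFlat R (Localization.Away f) := by
  have : Module.Flat R (Localization.Away f) :=
    have := IsLocalization.flat (Localization.Away f) (Submonoid.powers f)
    Module.Flat.trans R (MvPolynomial σ R) (Localization.Away f)
  refine ⟨fun {M} hM htop => ?_⟩
  have := hM.isPrime
  let K := FractionRing (MvPolynomial σ (R ⧸ M))
  let g : MvPolynomial σ R →+* K :=
    (algebraMap (MvPolynomial σ (R ⧸ M)) K).comp (MvPolynomial.map (Ideal.Quotient.mk M))
  have hg : IsUnit (g f) := by
    refine IsUnit.mk0 _ fun h => ?_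
    have h0 : MvPolynomial.map (Ideal.Quotient.mk M) f = 0 :=
      (IsFractionRing.injective (MvPolynomial σ (R ⧸ M)) K) (by rw [map_zero]; exact h)
    exact hM.ne_top (top_le_iff.mp (hf ▸ UnitContent.map_mk_eq_zero.mp h0))
  let l : Localization.Away f →+* K := IsLocalization.Away.lift f hg
  have key : ∀ x ∈ M • (⊤ : Submodule R (Localization.Away f)), l x = 0 := by
    intro x hx
    induction hx using Submodule.smul_induction_on' with
    | smul a ha y _ =>
      have e : l (algebraMap R (Localization.Away f) a) = 0 := by
        rw [IsScalarTower.algebraMap_apply R (MvPolynomial σ R), IsLocalization.Away.lift_eq]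
        change algebraMap (MvPolynomial σ (R ⧸ M)) K (MvPolynomial.map (Ideal.Quotient.mk M) (MvPolynomial.C a)) = 0
        rw [MvPolynomial.map_C, Ideal.Quotient.eq_zero_iff_mem.mpr ha, map_zero, map_zero]
      rw [Algebra.smul_def, map_mul, e, zero_mul]
    | add x _ y _ hx hy => rw [map_add, hx, hy, add_zero]
  have := key 1 (by rw [htop]; exact Submodule.mem_top)
  rw [map_one] at this
  exact one_ne_zero this

/-- A polynomial of unit content is invertible at some point over an extension. -/
theorem exists_isUnit_eval₂ (h2 : (2 : 𝕜) ≠ 0) (A : SuperAlg 𝕜) {σ : Type}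
    {f : MvPolynomial σ A.Even} (hf : UnitContent f) :
    ∃ (B : SuperAlg 𝕜) (φ : A ⟶ B) (x : σ → B.Even),
      Function.Injective (app φ) ∧ IsUnit (f.eval₂ (even φ) x) := by
  have := hf.faithfullyFlat_away
  -- The point is the tautological one: over the tensor product of A with A₀[x]_f, the coordinates
  -- are the variables themselves.
  let j := (A.extendScalar (Localization.Away f) h2).comp
    (algebraMap (MvPolynomial σ A.Even) (Localization.Away f))
  refine ⟨A.extend (Localization.Away f) h2, A.toExtend _ h2,
    fun i => j (MvPolynomial.X i), A.app_toExtend_injective _ h2, ?_⟩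
  have e : j = MvPolynomial.eval₂Hom (even (A.toExtend (Localization.Away f) h2))
      (fun i => j (MvPolynomial.X i)) := by
    refine MvPolynomial.ringHom_ext (fun c => ?_) (fun i => ?_)
    · rw [MvPolynomial.eval₂Hom_C, ← extendScalar_algebraMap,
        IsScalarTower.algebraMap_apply A.Even (MvPolynomial σ A.Even)]
      rfl
    · rw [MvPolynomial.eval₂Hom_X']
  have hu : IsUnit (j f) := (IsLocalization.Away.algebraMap_isUnit (S := Localization.Away f) f).map
    (A.extendScalar (Localization.Away f) h2)
  rw [e] at hu
  exact hu

end SuperAlg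

/-! ### Injectivity of the Plücker map -/

section Pluecker

open SuperAlg SMat

variable {𝕜 : Type u} [Field 𝕜] {A B : SuperAlg.{u} 𝕜} {n m r s : ℕ}

/-- A nilpotent displacement does not leave a principal open domain; P + ε therefore stays where the
two functions were assumed to agree. -/
theorem isUnit_eval₂_of_isNilpotent_sub {σ R S : Type*} [CommRing R] [CommRing S]
    (f : MvPolynomial σ R) (g : R →+* S) {x y : σ → S} (h : ∀ i, IsNilpotent (y i - x i))
    (hx : IsUnit (f.eval₂ g x)) : IsUnit (f.eval₂ g y) := by
  have e : f.eval₂ g y - f.eval₂ g x ∈ nilradical S := by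
    rw [← Ideal.Quotient.eq, MvPolynomial.hom_eval₂, MvPolynomial.hom_eval₂]
    congr 1
    funext i
    exact Ideal.Quotient.eq.mpr (mem_nilradical.mpr (h i))
  have := (mem_nilradical.mp e).isUnit_add_left_of_commute hx (Commute.all _ _)
  simpa using this

theorem SMat.isNilpotent_coord_addSingle (P : SMat A n m r s) (a : Fin n ⊕ Fin m)
    (i : Fin r ⊕ Fin s) (ε : A.carrier) (hε : ε ∈ A.gr (par a + par i)) (h0 : ε * ε = 0)
    (x : EvenCoord n m r s) : IsNilpotent ((P.addSingle a i ε hε).coord x - P.coord x) := by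
  refine ⟨2, Subtype.ext ?_⟩
  have key : ∀ k l, (P.val + Matrix.single a i ε) k l - P.val k l = 0 ∨
      (P.val + Matrix.single a i ε) k l - P.val k l = ε := by
    intro k l
    rw [Matrix.add_apply, add_sub_cancel_left, Matrix.single_apply]
    split_ifs <;> simp
  rw [pow_two]
  have sq : ∀ z : A.carrier, z = 0 ∨ z = ε → z * z = 0 := by
    rintro z (rfl | rfl)
    · exact mul_zero _
    · exact h0
  rcases x with x | x
  · exact sq _ (key (Sum.inl x.1) (Sum.inl x.2))
  · exact sq _ (key (Sum.inr x.1) (Sum.inr x.2))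

/-- The supermatrix with given even coordinates and zero odd coordinates. -/
def SMat.ofCoord (x : EvenCoord n m r s → A.Even) : SMat A n m r s where
  val := Matrix.fromBlocks (Matrix.of fun i j => (x (Sum.inl (i, j)) : A.carrier)) 0 0
    (Matrix.of fun i j => (x (Sum.inr (i, j)) : A.carrier))
  mem i j := by
    rcases i with i | i <;> rcases j with j | j
    · exact (x (Sum.inl (i, j))).2
    · exact zero_mem _
    · exact zero_mem _
    · exact (x (Sum.inr (i, j))).2

theorem SMat.coord_ofCoord (x : EvenCoord n m r s → A.Even) : (SMat.ofCoord x).coord = x := by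
  funext i
  rcases i with i | i <;> rfl

theorem exists_isUnit_eval₂_coord (h2 : (2 : 𝕜) ≠ 0)
    {f : MvPolynomial (EvenCoord n m r s) A.Even} (hf : UnitContent f) :
    ∃ (B : SuperAlg 𝕜) (φ : A ⟶ B) (P : SMat B n m r s),
      Function.Injective (app φ) ∧ IsUnit (f.eval₂ (SuperAlg.even φ) P.coord) := by
  obtain ⟨B, φ, x, hφ, hx⟩ := exists_isUnit_eval₂ h2 A hf
  exact ⟨B, φ, SMat.ofCoord x, hφ, by rwa [SMat.coord_ofCoord]⟩

/-- At a generic point over an extension, Ber(UP) is a unit. Were it zero, that extension would be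
trivial, and so would the algebra that embeds in it. -/
theorem pl_nowhereZero (h2 : (2 : 𝕜) ≠ 0) (U : Frame A n m r s) :
    RatClass.NowhereZero (Quotient.mk _ (pl U) : RatClass A n m r s) := by
  intro B φ hB h
  rw [pl_map] at h
  obtain ⟨f, hf, H⟩ := Quotient.exact h
  obtain ⟨C, ψ, P, hψ, hP⟩ :=
    exists_isUnit_eval₂_coord h2 (hf.mul (unitContent_plDenFull (U.map φ)))
  rw [MvPolynomial.eval₂_mul] at hP
  have hu := isUnit_ber ((isUnit_plDenFull_iff _ _ _).mp (isUnit_of_mul_isUnit_right hP))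
  have h0 : (((U.map φ).mat.map ψ).mul P).ber = 0 :=
    Subtype.ext (H C ψ P (isUnit_of_mul_isUnit_left hP)).2.2
  rw [h0] at hu
  have h1 : (1 : C.carrier) = 0 := congrArg Subtype.val (isUnit_zero_iff.mp hu).symm
  refine one_ne_zero (α := B.carrier) (hψ ?_)
  rw [_root_.map_one, map_zero, h1]

theorem SMat.map_injective {φ : A ⟶ B} (hφ : Function.Injective (app φ)) {M N : SMat A r s n m}
    (h : M.map φ = N.map φ) : M = N :=
  SMat.ext (by
    ext i j
    exact hφ (congrFun (congrFun (congrArg SMat.val h) i) j))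

/-- The rational function `Ber (U P)` determines the matrix `(U P)⁻¹ U` at generic points. -/
theorem exists_plW_eq (h2 : (2 : 𝕜) ≠ 0) {U U' : Frame A n m r s} (c : A.Even)
    (h : (Quotient.mk _ (pl U') : RatClass A n m r s) =
      RatClass.smul c (Quotient.mk _ (pl U))) :
    ∃ (B : SuperAlg 𝕜) (φ : A ⟶ B) (P : SMat B n m r s), Function.Injective (app φ) ∧
      ((U.mat.map φ).mul P).IsInv ∧ ((U'.mat.map φ).mul P).IsInv ∧
      plW U'.mat φ P = plW U.mat φ P := by
  obtain ⟨f, hf, H⟩ := Quotient.exact h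
  -- P is chosen where the two functions agree and where both UP and U'P are invertible.
  obtain ⟨B, φ, P, hφ, hP⟩ := exists_isUnit_eval₂_coord h2
    ((hf.mul (unitContent_plDenFull U)).mul (unitContent_plDenFull U'))
  rw [MvPolynomial.eval₂_mul, MvPolynomial.eval₂_mul] at hP
  have hf' := isUnit_of_mul_isUnit_left (isUnit_of_mul_isUnit_left hP)
  have hU := (isUnit_plDenFull_iff _ _ _).mp
    (isUnit_of_mul_isUnit_right (isUnit_of_mul_isUnit_left hP))
  have hU' := (isUnit_plDenFull_iff _ _ _).mp (isUnit_of_mul_isUnit_right hP)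
  refine ⟨B, φ, P, hφ, hU, hU', SMat.ext ?_⟩
  ext i a
  -- The functions are compared at P and at P + ε, with ε in the entry dual to W_{ia}.
  obtain ⟨C, ψ, ε, hε, h0, hψ⟩ := exists_sq_zero_extension h2 B (par a + par i)
  have hm : ∀ V : SMat A r s n m, (V.map (φ ≫ ψ)).mul (P.map ψ) = ((V.map φ).mul P).map ψ :=
    fun V => by rw [SMat.map_mul, SMat.map_comp]
  have hM : ((U.mat.map (φ ≫ ψ)).mul (P.map ψ)).IsInv := by rw [hm]; exact hU.map ψ
  have hM' : ((U'.mat.map (φ ≫ ψ)).mul (P.map ψ)).IsInv := by rw [hm]; exact hU'.map ψ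
  have hfψ : IsUnit (f.eval₂ (SuperAlg.even (φ ≫ ψ)) (P.map ψ).coord) := by
    have e : (P.map ψ).coord = SuperAlg.even ψ ∘ P.coord := by
      funext x
      rcases x with x | x <;> rfl
    rw [e, SuperAlg.even_comp, Function.comp_def, ← MvPolynomial.hom_eval₂]
    exact hf'.map _
  have e1 := (H C (φ ≫ ψ) _ hfψ).2.2
  have e2 := (H C (φ ≫ ψ) _ (isUnit_eval₂_of_isNilpotent_sub f _
    (SMat.isNilpotent_coord_addSingle (P.map ψ) a i ε hε h0) hfψ)).2.2
  have e1 : ((((U'.mat.map (φ ≫ ψ)).mul (P.map ψ)).ber : C.Even) : C.carrier) =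
    app (φ ≫ ψ) c * (((U.mat.map (φ ≫ ψ)).mul (P.map ψ)).ber : C.Even) := e1
  have e2 : ((((U'.mat.map (φ ≫ ψ)).mul ((P.map ψ).addSingle a i ε hε)).ber : C.Even) :
    C.carrier) = app (φ ≫ ψ) c *
      (((U.mat.map (φ ≫ ψ)).mul ((P.map ψ).addSingle a i ε hε)).ber : C.Even) := e2
  rw [ber_mul_addSingle _ _ a i ε hε h0 hM, ber_mul_addSingle _ _ a i ε hε h0 hM',
    ← mul_assoc (app (φ ≫ ψ) c), ← e1] at e2
  have hu : IsUnit ((((U'.mat.map (φ ≫ ψ)).mul (P.map ψ)).ber : C.Even) : C.carrier) :=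
    (isUnit_ber hM').map C.evenVal
  have e3 := add_left_cancel (hu.mul_left_cancel e2)
  have e4 := ((isUnit_one (M := C.carrier)).neg.pow (par i).val).mul_left_cancel e3
  have w : ∀ V : SMat A r s n m, ((V.map φ).mul P).IsInv →
      (((V.map (φ ≫ ψ)).mul (P.map ψ)).inv.mul (V.map (φ ≫ ψ))).val i a =
        app ψ ((plW V φ P).val i a) := fun V hV => by
    have := plW_map V φ ψ P hV
    rw [plW] at this
    rw [this]
    rfl
  rw [w _ hU, w _ hU'] at e4
  have e5 := hψ ((plW U'.mat φ P).val i a - (plW U.mat φ P).val i a) (by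
    rw [map_sub, sub_mul, e4, sub_self])
  exact sub_eq_zero.mp e5

/-- The Plücker transform determines the plane. -/
theorem rel_of_pl_eq_smul (h2 : (2 : 𝕜) ≠ 0) {U U' : Frame A n m r s} (c : A.Even)
    (h : (Quotient.mk _ (pl U') : RatClass A n m r s) =
      RatClass.smul c (Quotient.mk _ (pl U))) : U ≈ U' := by
  obtain ⟨B, φ, P, hφ, hU, hU', hW⟩ := exists_plW_eq h2 c h
  obtain ⟨a, μ, hk⟩ := U.rank
  have e1 : U'.mat.map φ =
      (((U'.mat.map φ).mul P).mul ((U.mat.map φ).mul P).inv).mul (U.mat.map φ) := by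
    rw [mul_assoc']
    change _ = SMat.mul _ (plW U.mat φ P)
    rw [← hW, plW, mul_inv_cancel hU']
  set G := ((U'.mat.map φ).mul P).mul ((U.mat.map φ).mul P).inv
  have e2 : (U'.mat.cols a μ).map φ = G.mul ((U.mat.cols a μ).map φ) :=
    congrArg (fun M => SMat.cols M a μ) e1
  -- Restricting U' = GU to columns in which U is invertible shows that G comes from A; as A embeds
  -- in B, the identity itself descends.
  have e3 : G = ((U'.mat.cols a μ).mul (U.mat.cols a μ).inv).map φ := by
    rw [SMat.map_mul, e2, ← SMat.map_inv φ hk, mul_assoc', mul_inv (hk.map φ), mul_one']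
  rw [e3, ← SMat.map_mul] at e1
  have e4 := SMat.map_injective hφ e1
  refine ⟨_, ?_, e4⟩
  -- Columns in which U' is invertible exhibit G as a left factor of an invertible square matrix.
  obtain ⟨b, ν, hb⟩ := U'.rank
  rw [e4, mul_cols] at hb
  exact isInv_of_mul hb

/-! ### The Plücker map -/

/-- The homogeneous coordinates `(pl U, pl* U)` of a plane. -/
noncomputable def plPair (h2 : (2 : 𝕜) ≠ 0) (U : Frame A n m r s) : MvPair A n m r s where
  F := Quotient.mk _ (pl U)
  G := Quotient.mk _ (plStar U)
  F_mv := pl_isMultivector U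
  G_mv := pl_isMultivector U.pi
  F_ne := pl_nowhereZero h2 U
  G_ne := pl_nowhereZero h2 U.pi

theorem plPair_map (h2 : (2 : 𝕜) ≠ 0) (φ : A ⟶ B) (U : Frame A n m r s) :
    (plPair h2 U).map φ = plPair h2 (U.map φ) :=
  MvPair.ext (pl_map φ U) (pl_map φ U.pi)

/-- The scalar is λ = Ber g, and pl* acquires the factor Ber(g^Π) = λ⁻¹. -/
theorem plPair_rel (h2 : (2 : 𝕜) ≠ 0) {U U' : Frame A n m r s} (h : U ≈ U') :
    plPair h2 U ≈ plPair h2 U' := by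
  obtain ⟨g, hg, e⟩ := h
  refine ⟨⟨g.ber, g.pi.ber, ber_mul_ber_pi hg, ?_⟩, pl_mul hg e, pl_mul hg.pi ?_⟩
  · rw [mul_comm, ber_mul_ber_pi hg]
  · change U'.mat.pi = _
    rw [e, pi_mul]
    rfl

/-- The super Plücker map. -/
noncomputable def pluecker (h2 : (2 : 𝕜) ≠ 0) (n m r s : ℕ) :
    -- A rational function takes values at matrices over all superalgebras of universe `u`, so the
    -- target lies one universe higher.
    superGrassmannian 𝕜 n m r s ⋙ uliftFunctor.{u + 1, u} ⟶ weightedProj 𝕜 n m r s where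
  app A := TypeCat.ofHom fun x =>
    Quotient.map (plPair h2) (fun _ _ h => plPair_rel h2 h) x.down
  naturality A B φ := by
    ext ⟨x⟩
    induction x using Quotient.inductionOn with | _ U
    exact congrArg (Quotient.mk _) (plPair_map h2 φ U).symm

theorem pluecker_app_injective (h2 : (2 : 𝕜) ≠ 0) (n m r s : ℕ) (A : SuperAlg.{u} 𝕜) :
    Function.Injective ((pluecker h2 n m r s).app A) := by
  rintro ⟨x⟩ ⟨y⟩ h
  induction x using Quotient.inductionOn with | _ U
  induction y using Quotient.inductionOn with | _ U'
  obtain ⟨c, hF, -⟩ := Quotient.exact (s := MvPair.setoid A n m r s) h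
  exact congrArg ULift.up (Quotient.sound (rel_of_pl_eq_smul h2 c hF))

end Pluecker

theorem mainTheorem1 {𝕜 : Type u} [Field 𝕜] (h2 : (2 : 𝕜) ≠ 0) (n m r s : ℕ)
    (hr : r ≤ n) (hs : s ≤ m) :
    ∃ Pl : superGrassmannian 𝕜 n m r s ⋙ uliftFunctor.{u + 1, u} ⟶ weightedProj 𝕜 n m r s,
      (∀ (A : SuperAlg.{u} 𝕜) (U : Frame A n m r s), ∃ x : MvPair A n m r s,
        x.F = Quotient.mk _ (pl U) ∧ x.G = Quotient.mk _ (plStar U) ∧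
          Pl.app A (ULift.up (Quotient.mk _ U)) = Quotient.mk _ x) ∧
      IsIso (Subfunctor.toRange Pl) := by
  refine ⟨pluecker h2 n m r s, fun A U => ⟨plPair h2 U, rfl, rfl, rfl⟩, ?_⟩
  -- Injectivity on A-points makes the transformation a monomorphism, hence an isomorphism onto its
  -- range; the inverse is automatically natural in A.
  have : ∀ A, Mono ((pluecker h2 n m r s).app A) := fun A =>
    (mono_iff_injective _).mpr (pluecker_app_injective h2 n m r s A)
  have := NatTrans.mono_of_mono_app (pluecker h2 n m r s)
  infer_instance
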